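/- Let $d\ge 0$ be an integer and $\alpha>-1/2$. On $\mathbb{R}^{d+1}_+=\mathbb{R}^d\times(0,\infty)$, with points written $x=(x',x_{d+1})$, let $$d\mu_\alpha(x)=\frac{x_{d+1}^{2\alpha+1}}{(2\pi)^{d/2}\,2^{\alpha}\,\Gamma(\alpha+1)}\,dx,$$ let $\|\cdot\|_{\alpha,p}$ be the norm of $L^p_\alpha=L^p(\mathbb{R}^{d+1}_+,\mu_\alpha)$ (complex-valued functions), and let $$\Lambda(x,\lambda)=e^{-i\langle x',\lambda'\rangle}\,j_\alpha(x_{d+1}\lambda_{d+1}),\qquad j_\alpha(t)=\Gamma(\alpha+1)\sum_{k=0}^\infty\frac{(-1)^k t^{2k}}{2^{2k}\,k!\,\Gamma(\alpha+k+1)}.$$ The Weinstein transform is $\mathcal{F}\varphi(\lambda)=\int_{\mathbb{R}^{d+1}_+}\varphi(x)\Lambda(x,\lambda)\,d\mu_\alpha(x)$ for $\varphi\in L^1_\alpha$. For $1\le p\le 2$ and $q=p/(p-1)$ ($q=\infty$ if $p=1$), $\mathcal{F}:L^p_\alpha\to L^q_\alpha$ denotes its extension by continuity from $L^1_\alpha\cap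 L^p_\alpha$. For measurable $\Omega,\Sigma\subseteq\mathbb{R}^{d+1}_+$ put $P_\Omega\varphi=\varphi\chi_\Omega$, and let $Q_\Sigma$ be defined by $\mathcal{F}(Q_\Sigma\varphi)=\mathcal{F}(\varphi)\chi_\Sigma$. A function $\psi\in L^p_\alpha$ is bandlimited to $\Sigma$ if $Q_\Sigma\psi=\psi$. For $\varepsilon\ge 0$, a function $\varphi\in L^p_\alpha$ is $\varepsilon$-bandlimited to $\Sigma$ in $L^p_\alpha$-norm if there is $\psi\in L^p_\alpha$ bandlimited to $\Sigma$ with $\|\varphi-\psi\|_{\alpha,p}\le\varepsilon\|\varphi\|_{\alpha,p}$. Theorem. Let $1\le p\le 2$ and let $\Omega,\Sigma\subseteq\mathbb{R}^{d+1}_+$ be measurable (possibly of infinite measure, with the convention $0\cdot\infty=0$). (1) If $\psi\in L^p_\alpha$ is bandlimited to $\Sigma$, then $$\|P_\Omega\psi\|_{\alpha,p}\le\mu_\alpha(\Sigma)^{1/p}\,\mu_\alpha(\Omega)^{1/p}\,\|\psi\|_{\alpha,p}.$$ (2) If $\varepsilon_\Sigma\ge 0$ and $\varphi\in L^p_\alpha$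 is $\varepsilon_\Sigma$-bandlimited to $\Sigma$ in $L^p_\alpha$-norm, then $$\|P_\Omega\varphi\|_{\alpha,p}\le\Big((1+\varepsilon_\Sigma)\,\mu_\alpha(\Sigma)^{1/p}\,\mu_\alpha(\Omega)^{1/p}+\varepsilon_\Sigma\Big)\|\varphi\|_{\alpha,p}.$$ -/

import Mathlib

open MeasureTheory Filter Topology
open scoped ENNReal NNReal

noncomputable section

/-- The ambient space `ℝ^d × ℝ` of `ℝ^{d+1}_+ = ℝ^d × (0, ∞)`. A point is written
`x = (x', x_{d+1})` with `x' = x.1` and `x_{d+1} = x.2`. -/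
abbrev WSpace (d : ℕ) : Type := EuclideanSpace ℝ (Fin d) × ℝ

/-- The open half space `ℝ^{d+1}_+ = ℝ^d × (0, ∞)`. -/
def halfSpace (d : ℕ) : Set (WSpace d) := {x | 0 < x.2}

/-- The measure `dμ_α(x) = x_{d+1}^{2α+1} / ((2π)^{d/2} 2^α Γ(α+1)) dx` on `ℝ^{d+1}_+`.
It is regarded as a measure on the ambient space that is carried by `ℝ^{d+1}_+`, so functions
and sets matter only through their restrictions to the half space. -/
def weinsteinMeasure (d : ℕ) (α : ℝ) : Measure (WSpace d) :=
  ((volume : Measure (WSpace d)).restrict (halfSpace d)).withDensity fun x =>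
    ENNReal.ofReal
      (x.2 ^ (2 * α + 1) / ((2 * Real.pi) ^ ((d : ℝ) / 2) * 2 ^ α * Real.Gamma (α + 1)))

/-- The normalized Bessel function
`j_α(t) = Γ(α+1) ∑_k (-1)^k t^{2k} / (2^{2k} k! Γ(α+k+1))`. -/
def normBessel (α t : ℝ) : ℝ :=
  Real.Gamma (α + 1) * ∑' k : ℕ,
    (-1 : ℝ) ^ k * t ^ (2 * k) / (2 ^ (2 * k) * (k.factorial : ℝ) * Real.Gamma (α + k + 1))

/-- The Weinstein kernel `Λ(x, y) = exp(-i ⟨x', y'⟩) j_α(x_{d+1} y_{d+1})`. -/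
def weinsteinKernel {d : ℕ} (α : ℝ) (x y : WSpace d) : ℂ :=
  Complex.exp (-Complex.I * ((inner ℝ x.1 y.1 : ℝ) : ℂ)) * ((normBessel α (x.2 * y.2) : ℝ) : ℂ)

/-- The Weinstein transform of an integrable function, as an integral. -/
def weinsteinIntegral {d : ℕ} (α : ℝ) (f : WSpace d → ℂ) (y : WSpace d) : ℂ :=
  ∫ x, f x * weinsteinKernel α x y ∂(weinsteinMeasure d α)

/-- `g ∈ L^q_α` is (a representative of) the Weinstein transform of `f ∈ L^p_α`, where
`q = p / (p - 1)` (`q = ∞` if `p = 1`): the transform on `L^p_α`, `1 ≤ p ≤ 2`, is the extension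
by continuity, as a map `L^p_α → L^q_α`, of the integral transform on the dense subspace
`L^1_α ∩ L^p_α`. -/
def IsWeinsteinTransform {d : ℕ} (α : ℝ) (p : ℝ≥0∞) (f g : WSpace d → ℂ) : Prop :=
  MemLp f p (weinsteinMeasure d α) ∧
  MemLp g (ENNReal.conjExponent p) (weinsteinMeasure d α) ∧
  ∃ u : ℕ → WSpace d → ℂ,
    (∀ n, MemLp (u n) 1 (weinsteinMeasure d α)) ∧
    (∀ n, MemLp (u n) p (weinsteinMeasure d α)) ∧
    Tendsto (fun n => eLpNorm (u n - f) p (weinsteinMeasure d α)) atTop (𝓝 0) ∧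
    Tendsto (fun n => eLpNorm (weinsteinIntegral α (u n) - g) (ENNReal.conjExponent p)
      (weinsteinMeasure d α)) atTop (𝓝 0)

/-- The time-limiting operator `P_Ω φ = φ χ_Ω`. -/
def timeLimit {d : ℕ} (Ω : Set (WSpace d)) (φ : WSpace d → ℂ) : WSpace d → ℂ :=
  Ω.indicator φ

/-- `ω = Q_S φ` in `L^p_α`, where the operator `Q_S` is defined by
`F(Q_S φ) = F(φ) χ_S`, `F` being the Weinstein transform. -/
def IsBandProjection {d : ℕ} (α : ℝ) (p : ℝ≥0∞) (S : Set (WSpace d))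
    (φ ω : WSpace d → ℂ) : Prop :=
  ∃ g, IsWeinsteinTransform α p φ g ∧ IsWeinsteinTransform α p ω (S.indicator g)

/-- `ψ ∈ L^p_α` is bandlimited to `S`: `Q_S ψ = ψ`. -/
def IsBandlimited {d : ℕ} (α : ℝ) (p : ℝ≥0∞) (S : Set (WSpace d)) (ψ : WSpace d → ℂ) : Prop :=
  MemLp ψ p (weinsteinMeasure d α) ∧ IsBandProjection α p S ψ ψ

/-- `φ` is `ε`-bandlimited to `S` in the `L^p_α`-norm. -/
def IsEpsBandlimited {d : ℕ} (α : ℝ) (p : ℝ≥0∞) (S : Set (WSpace d)) (ε : ℝ≥0)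
    (φ : WSpace d → ℂ) : Prop :=
  ∃ ψ, IsBandlimited α p S ψ ∧
    eLpNorm (φ - ψ) p (weinsteinMeasure d α) ≤ ε * eLpNorm φ p (weinsteinMeasure d α)

end

/-!
The heart of the matter is the bound `‖ψ‖_∞ ≤ μ_α(Σ)^{1/p} ‖ψ‖_p` for `ψ ∈ L^p_α` bandlimited to a
set `Σ` of finite measure (`IsBandlimited.eLpNorm_top_le`). The concentration inequality then
follows by integrating over `Ω`, and its `ε`-version by the triangle inequality; if `Σ` has infinite
measure, there is hardly anything to prove.

The usual way to this bound is the Hausdorff–Young inequality, which rests on Riesz–Thorin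
interpolation. It is avoided here. Let `G` be the transform of `ψ`, carried by `Σ`. Since `G` lies
in `L^q` with `q ≥ 2` and `Σ` has finite measure, `G` lies in `L^1` and in `L^2`. By inversion
(`IsWeinsteinTransform.ae_eq_star_weinsteinIntegral`) and `|Λ| ≤ 1`, `ψ` is bounded by `‖G‖_1`, so
`ψ` lies in `L^p ∩ L^∞`, hence in `L^2`, and by the Plancherel inequality `‖G‖_2 ≤ ‖ψ‖_2`
(`IsWeinsteinTransform.eLpNorm_two_le`)
`‖ψ‖_∞ ≤ ‖G‖_1 ≤ μ_α(Σ)^{1/2} ‖G‖_2 ≤ μ_α(Σ)^{1/2} ‖ψ‖_2 ≤ μ_α(Σ)^{1/2} ‖ψ‖_p^{p/2} ‖ψ‖_∞^{1-p/2}`.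
As `‖ψ‖_∞` is finite, the last factor can be absorbed, and the exponents come out exactly right.

Inversion and Plancherel are obtained by duality with explicit Gaussians. The transform is symmetric
for the bilinear pairing, on `L^1` by Fubini and for transform pairs by passing to the limit
(`IsWeinsteinTransform.integral_mul_eq`). The transforms of the Gaussians
`exp(-|x'|²/2 + i⟨ξ, x'⟩ - a x_{d+1}²/2)` are computed from the Bessel series, and these Gaussians
separate functions (`ae_eq_zero_of_integral_mul_modulatedGaussian_eq_zero`), because characters in
`x'` times Laplace kernels in `x_{d+1}²` span a separating algebra. Finally `|Λ| ≤ 1` comes from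
Poisson's integral for `j_α` (`normBessel_eq_integral_cos`).
-/

variable {d : ℕ} {α : ℝ}

/-! ### The normalized Bessel function -/

lemma integral_betaPDFReal {a b : ℝ} (ha : 0 < a) (hb : 0 < b) :
    ∫ x, ProbabilityTheory.betaPDFReal a b x = 1 := by
  have hnn : ∀ x, 0 ≤ ProbabilityTheory.betaPDFReal a b x := fun x => by
    by_cases hx : 0 < x ∧ x < 1
    · exact (ProbabilityTheory.betaPDFReal_pos hx.1 hx.2 ha hb).le
    · simp [ProbabilityTheory.betaPDFReal, hx]
  rw [integral_eq_lintegral_of_nonneg_ae (ae_of_all _ hnn) (by fun_prop)]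
  have := ProbabilityTheory.lintegral_betaPDF_eq_one ha hb
  simp only [ProbabilityTheory.betaPDF] at this
  simp [this]

/-- Moments of the beta distribution. -/
lemma integral_betaMeasure_pow {a b : ℝ} (ha : 0 < a) (hb : 0 < b) (k : ℕ) :
    ∫ x, x ^ k ∂(ProbabilityTheory.betaMeasure a b) =
      ProbabilityTheory.beta (a + k) b / ProbabilityTheory.beta a b := by
  have hak : 0 < a + k := by positivity
  have h0 := ProbabilityTheory.beta_pos ha hb
  have h1 := ProbabilityTheory.beta_pos hak hb
  rw [ProbabilityTheory.betaMeasure, integral_withDensity_eq_integral_toReal_smul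
    (by unfold ProbabilityTheory.betaPDF; fun_prop)
    (ae_of_all _ fun x => by simp [ProbabilityTheory.betaPDF])]
  have : ∀ x, (ProbabilityTheory.betaPDF a b x).toReal • x ^ k =
      ProbabilityTheory.beta (a + k) b / ProbabilityTheory.beta a b *
        ProbabilityTheory.betaPDFReal (a + k) b x := fun x => by
    by_cases hx : 0 < x ∧ x < 1
    · rw [ProbabilityTheory.betaPDF,
        ENNReal.toReal_ofReal (ProbabilityTheory.betaPDFReal_pos hx.1 hx.2 ha hb).le]
      simp only [ProbabilityTheory.betaPDFReal, if_pos hx, smul_eq_mul]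
      rw [show a + k - 1 = (a - 1) + (k : ℕ) by ring, Real.rpow_add_natCast hx.1.ne']
      field_simp
    · simp [ProbabilityTheory.betaPDF, ProbabilityTheory.betaPDFReal, hx]
  simp_rw [this]
  rw [integral_const_mul, integral_betaPDFReal hak hb, mul_one]

lemma ae_betaMeasure_mem_Ioo (a b : ℝ) :
    ∀ᵐ x ∂(ProbabilityTheory.betaMeasure a b), 0 < x ∧ x < 1 := by
  rw [ProbabilityTheory.betaMeasure,
    ae_withDensity_iff (by unfold ProbabilityTheory.betaPDF; fun_prop)]
  refine ae_of_all _ fun x hx => ?_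
  by_contra h
  exact hx (by simp [ProbabilityTheory.betaPDF, ProbabilityTheory.betaPDFReal, h])

/-- The duplication formula at half-integers, in the form that turns the cosine series into the
Bessel series. -/
lemma Gamma_nat_add_half_div_factorial (k : ℕ) :
    Real.Gamma (k + 1 / 2) / ((2 * k).factorial : ℝ) =
      Real.Gamma (1 / 2) / (2 ^ (2 * k) * (k.factorial : ℝ)) := by
  induction k with
  | zero => simp
  | succ k ih =>
    have h : (((k + 1 : ℕ) : ℝ) + 1 / 2) = (k + 1 / 2 : ℝ) + 1 := by push_cast; ring
    rw [h, Real.Gamma_add_one (by positivity)]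
    rw [show 2 * (k + 1) = 2 * k + 1 + 1 by ring, Nat.factorial_succ, Nat.factorial_succ,
      Nat.factorial_succ]
    have h2 : Real.Gamma (k + 1 / 2) = Real.Gamma (1 / 2) / (2 ^ (2 * k) * (k.factorial : ℝ)) *
        ((2 * k).factorial : ℝ) := by
      rw [← ih]; field_simp
    rw [h2]
    push_cast
    field_simp
    ring

/-- Poisson's integral: with `ν` the beta distribution of parameters `1/2` and `α + 1/2`, the
variable being the square of the usual one, `j_α(t) = ∫ cos(t√s) dν(s)`. This is where
`α > -1/2` is needed. That `ν` is a probability measure gives the sharp bound `|j_α| ≤ 1`. -/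
theorem normBessel_eq_integral_cos {α : ℝ} (hα : -1 / 2 < α) (t : ℝ) :
    normBessel α t =
      ∫ s, Real.cos (t * √s) ∂(ProbabilityTheory.betaMeasure (1 / 2) (α + 1 / 2)) := by
  have hb : 0 < α + 1 / 2 := by linarith
  have hh : (0 : ℝ) < 1 / 2 := by norm_num
  set ν := ProbabilityTheory.betaMeasure (1 / 2) (α + 1 / 2)
  have : IsProbabilityMeasure ν := ProbabilityTheory.isProbabilityMeasureBeta hh hb
  have key := hasSum_integral_of_dominated_convergence (μ := ν)
    (F := fun (k : ℕ) s => (-1 : ℝ) ^ k * (t * √s) ^ (2 * k) / ((2 * k).factorial : ℝ))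
    (f := fun s => Real.cos (t * √s)) (fun (k : ℕ) _ => |t| ^ (2 * k) / ((2 * k).factorial : ℝ))
    (fun k => by
      refine Measurable.aestronglyMeasurable ?_
      fun_prop)
    (fun k => by
      filter_upwards [ae_betaMeasure_mem_Ioo (1 / 2) (α + 1 / 2)] with s hs
      have h1 : √s ≤ 1 := Real.sqrt_le_one.2 hs.2.le
      simp only [norm_div, norm_mul, norm_pow, norm_neg, norm_one, one_pow, one_mul,
        Real.norm_eq_abs, abs_of_nonneg (Real.sqrt_nonneg s), Nat.abs_cast]
      gcongr
      exact mul_le_of_le_one_right (abs_nonneg _) h1)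
    (ae_of_all _ fun s => (Real.hasSum_cosh |t|).summable)
    (integrable_const _)
    (ae_of_all _ fun s => Real.hasSum_cos _)
  rw [← key.tsum_eq, normBessel, ← tsum_mul_left]
  congr 1
  ext k
  have hG1 : 0 < Real.Gamma (α + 1) := Real.Gamma_pos_of_pos (by linarith)
  have hG2 : 0 < Real.Gamma (α + k + 1) :=
    Real.Gamma_pos_of_pos (by have : (0 : ℝ) ≤ k := k.cast_nonneg; linarith)
  have hG3 : 0 < Real.Gamma (α + 1 / 2) := Real.Gamma_pos_of_pos hb
  have hG4 : 0 < Real.Gamma (1 / 2) := Real.Gamma_pos_of_pos hh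
  have hI : ∫ s, (-1 : ℝ) ^ k * (t * √s) ^ (2 * k) / ((2 * k).factorial : ℝ) ∂ν =
      (-1 : ℝ) ^ k * t ^ (2 * k) / ((2 * k).factorial : ℝ) * ∫ s, s ^ k ∂ν := by
    rw [← integral_const_mul]
    refine integral_congr_ae ?_
    filter_upwards [ae_betaMeasure_mem_Ioo (1 / 2) (α + 1 / 2)] with s hs
    rw [mul_pow, pow_mul (√s), Real.sq_sqrt hs.1.le]
    ring
  rw [hI, integral_betaMeasure_pow hh hb, ProbabilityTheory.beta, ProbabilityTheory.beta]
  have hf := Gamma_nat_add_half_div_factorial k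
  rw [add_comm (k : ℝ)] at hf
  have e1 : (1 / 2 + k + (α + 1 / 2) : ℝ) = α + k + 1 := by ring
  have e2 : (1 / 2 + (α + 1 / 2) : ℝ) = α + 1 := by ring
  rw [e1, e2]
  rw [div_eq_iff (by positivity)] at hf
  rw [hf]
  set A := Real.Gamma (α + 1 / 2)
  field_simp

lemma abs_normBessel_le_one {α : ℝ} (hα : -1 / 2 < α) (t : ℝ) : |normBessel α t| ≤ 1 := by
  have := ProbabilityTheory.isProbabilityMeasureBeta (α := 1 / 2) (β := α + 1 / 2)
    (by norm_num) (by linarith)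
  rw [normBessel_eq_integral_cos hα]
  have h := norm_integral_le_of_norm_le_const
    (μ := ProbabilityTheory.betaMeasure (1 / 2) (α + 1 / 2))
    (f := fun s => Real.cos (t * √s)) (C := 1) (ae_of_all _ fun s => Real.abs_cos_le_one _)
  rwa [probReal_univ, mul_one] at h

lemma continuous_normBessel {α : ℝ} (hα : -1 / 2 < α) : Continuous (normBessel α) := by
  have := ProbabilityTheory.isProbabilityMeasureBeta (α := 1 / 2) (β := α + 1 / 2)
    (by norm_num) (by linarith)
  rw [funext (normBessel_eq_integral_cos hα)]
  refine continuous_of_dominated (bound := fun _ => 1)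
    (fun t => Measurable.aestronglyMeasurable (by fun_prop))
    (fun t => ae_of_all _ fun s => Real.abs_cos_le_one _) (integrable_const _)
    (ae_of_all _ fun s => by fun_prop)


/-! ### The Weinstein kernel and the transform of integrable functions -/

lemma continuous_weinsteinKernel (hα : -1 / 2 < α) :
    Continuous fun z : WSpace d × WSpace d => weinsteinKernel α z.1 z.2 := by
  have := continuous_normBessel hα
  unfold weinsteinKernel
  fun_prop

lemma norm_weinsteinKernel_le_one (hα : -1 / 2 < α) (x y : WSpace d) :
    ‖weinsteinKernel α x y‖ ≤ 1 := by
  have h : ‖Complex.exp (-Complex.I * ((inner ℝ x.1 y.1 : ℝ) : ℂ))‖ = 1 := by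
    rw [Complex.norm_exp]; simp
  rw [weinsteinKernel, norm_mul, h, one_mul, Complex.norm_real]
  exact abs_normBessel_le_one hα _

lemma weinsteinKernel_comm (x y : WSpace d) :
    weinsteinKernel α x y = weinsteinKernel α y x := by
  simp only [weinsteinKernel, real_inner_comm, mul_comm]

instance sigmaFinite_weinsteinMeasure : SigmaFinite (weinsteinMeasure d α) := by
  unfold weinsteinMeasure
  exact SigmaFinite.withDensity_ofReal _

lemma integrable_mul_weinsteinKernel (hα : -1 / 2 < α) {u : WSpace d → ℂ}
    (hu : Integrable u (weinsteinMeasure d α)) (y : WSpace d) :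
    Integrable (fun x => u x * weinsteinKernel α x y) (weinsteinMeasure d α) := by
  refine hu.mul_bdd (c := 1) ?_ (ae_of_all _ fun x => norm_weinsteinKernel_le_one hα x y)
  exact ((continuous_weinsteinKernel hα).comp (by fun_prop :
    Continuous fun x => (x, y))).aestronglyMeasurable

lemma norm_weinsteinIntegral_le (hα : -1 / 2 < α) {u : WSpace d → ℂ}
    (hu : Integrable u (weinsteinMeasure d α)) (y : WSpace d) :
    ‖weinsteinIntegral α u y‖ ≤ ∫ x, ‖u x‖ ∂(weinsteinMeasure d α) := by
  refine norm_integral_le_of_norm_le hu.norm (ae_of_all _ fun x => ?_)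
  rw [norm_mul]
  exact mul_le_of_le_one_right (norm_nonneg _) (norm_weinsteinKernel_le_one hα x y)

lemma continuous_weinsteinIntegral (hα : -1 / 2 < α) {u : WSpace d → ℂ}
    (hu : Integrable u (weinsteinMeasure d α)) : Continuous (weinsteinIntegral α u) := by
  refine continuous_of_dominated (bound := fun x => ‖u x‖)
    (fun y => (integrable_mul_weinsteinKernel hα hu y).1)
    (fun y => ae_of_all _ fun x => ?_) hu.norm (ae_of_all _ fun x => ?_)
  · rw [norm_mul]
    exact mul_le_of_le_one_right (norm_nonneg _) (norm_weinsteinKernel_le_one hα x y)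
  · have h : Continuous fun y : WSpace d => weinsteinKernel α x y := by
      have := continuous_normBessel hα
      unfold weinsteinKernel
      fun_prop
    exact h.const_mul (u x)

/-- The transform is symmetric for the bilinear pairing, by Fubini and the symmetry of
the kernel. -/
theorem integral_weinsteinIntegral_mul (hα : -1 / 2 < α) {u v : WSpace d → ℂ}
    (hu : Integrable u (weinsteinMeasure d α)) (hv : Integrable v (weinsteinMeasure d α)) :
    ∫ y, weinsteinIntegral α u y * v y ∂(weinsteinMeasure d α) =
      ∫ x, u x * weinsteinIntegral α v x ∂(weinsteinMeasure d α) := by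
  simp only [weinsteinIntegral]
  simp_rw [← integral_mul_const, ← integral_const_mul]
  rw [integral_integral_swap]
  · refine integral_congr_ae (ae_of_all _ fun x => integral_congr_ae (ae_of_all _ fun y => ?_))
    simp only [weinsteinKernel_comm x y]
    ring
  · have h := (hv.mul_prod hu).bdd_mul (c := 1)
      (f := fun z : WSpace d × WSpace d => weinsteinKernel α z.2 z.1)
      ((continuous_weinsteinKernel hα).comp continuous_swap).aestronglyMeasurable
      (ae_of_all _ fun z => norm_weinsteinKernel_le_one hα z.2 z.1)
    refine h.congr (ae_of_all _ fun z => ?_)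
    simp only [Function.uncurry]
    ring

/-! ### The radial factor of the measure -/

/-- The measure on `(0, ∞)`, as a measure on `ℝ`, whose product with Lebesgue measure on `ℝ^d` is
`μ_α`. The whole normalizing constant is put into this factor, so it depends on `d`. -/
noncomputable def radialMeasure (d : ℕ) (α : ℝ) : Measure ℝ :=
  ((volume : Measure ℝ).restrict (Set.Ioi 0)).withDensity fun t =>
    ENNReal.ofReal
      (t ^ (2 * α + 1) / ((2 * Real.pi) ^ ((d : ℝ) / 2) * 2 ^ α * Real.Gamma (α + 1)))

instance sigmaFinite_radialMeasure : SigmaFinite (radialMeasure d α) := by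
  unfold radialMeasure
  exact SigmaFinite.withDensity_ofReal _

lemma weinsteinMeasure_eq_prod :
    weinsteinMeasure d α =
      (volume : Measure (EuclideanSpace ℝ (Fin d))).prod (radialMeasure d α) := by
  rw [radialMeasure, prod_withDensity_right (by fun_prop), weinsteinMeasure,
    Measure.volume_eq_prod]
  congr 1
  conv_rhs => rw [← Measure.restrict_univ (μ := (volume : Measure (EuclideanSpace ℝ (Fin d))))]
  rw [Measure.prod_restrict]
  congr 1
  ext x
  simp [halfSpace]

lemma ae_pos_weinsteinMeasure : ∀ᵐ x ∂(weinsteinMeasure d α), 0 < x.2 := by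
  have h : MeasurableSet (halfSpace d) := measurableSet_lt measurable_const measurable_snd
  exact (withDensity_absolutelyContinuous _ _).ae_le (ae_restrict_mem h)

lemma integral_radialMeasure (hα : -1 / 2 < α) (f : ℝ → ℝ) :
    ∫ t, f t ∂(radialMeasure d α) =
      ∫ t in Set.Ioi 0, t ^ (2 * α + 1) /
        ((2 * Real.pi) ^ ((d : ℝ) / 2) * 2 ^ α * Real.Gamma (α + 1)) * f t := by
  have hG : 0 < Real.Gamma (α + 1) := Real.Gamma_pos_of_pos (by linarith)
  rw [radialMeasure, integral_withDensity_eq_integral_toReal_smul (by fun_prop)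
    (ae_of_all _ fun _ => ENNReal.ofReal_lt_top)]
  refine setIntegral_congr_fun measurableSet_Ioi fun t ht => ?_
  have ht : 0 < t := ht
  rw [ENNReal.toReal_ofReal (by positivity), smul_eq_mul]

lemma integral_gaussian_pow_radialMeasure (hα : -1 / 2 < α) {a : ℝ} (ha : 0 < a) (k : ℕ) :
    ∫ t, Real.exp (-(a * t ^ 2 / 2)) * t ^ (2 * k) ∂(radialMeasure d α) =
      a ^ (-(α + 1)) * (2 / a) ^ k * Real.Gamma (α + k + 1) /
        ((2 * Real.pi) ^ ((d : ℝ) / 2) * Real.Gamma (α + 1)) := by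
  have hk : (0 : ℝ) ≤ k := k.cast_nonneg
  have hG : 0 < Real.Gamma (α + 1) := Real.Gamma_pos_of_pos (by linarith)
  rw [integral_radialMeasure hα]
  have h := integral_rpow_mul_exp_neg_mul_rpow (p := 2) (q := 2 * α + 1 + 2 * k) (b := a / 2)
    two_pos (by linarith) (by positivity)
  calc _ = ∫ t in Set.Ioi (0 : ℝ),
        1 / ((2 * Real.pi) ^ ((d : ℝ) / 2) * 2 ^ α * Real.Gamma (α + 1)) *
          (t ^ (2 * α + 1 + 2 * k) * Real.exp (-(a / 2) * t ^ (2 : ℝ))) := by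
        refine setIntegral_congr_fun measurableSet_Ioi fun t ht => ?_
        have ht : 0 < t := ht
        have e : (2 * α + 1 + 2 * k : ℝ) = (2 * α + 1) + ((2 * k : ℕ) : ℝ) := by push_cast; ring
        rw [e, Real.rpow_add_natCast ht.ne', Real.rpow_two,
          show -(a / 2) * t ^ 2 = -(a * t ^ 2 / 2) by ring]
        ring
    _ = _ := by
        rw [integral_const_mul, h]
        have e1 : (2 * α + 1 + 2 * k + 1) / 2 = α + k + 1 := by ring
        have e2 : -(2 * α + 1 + 2 * k + 1) / 2 = -(α + 1) - (k : ℕ) := by ring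
        rw [e1, e2, Real.rpow_sub_natCast (by positivity), Real.div_rpow ha.le zero_le_two,
          Real.rpow_neg zero_le_two, Real.rpow_add_one two_ne_zero, div_pow, div_pow]
        field_simp

lemma integrable_gaussian_pow_radialMeasure (hα : -1 / 2 < α) {a : ℝ} (ha : 0 < a) (k : ℕ) :
    Integrable (fun t => Real.exp (-(a * t ^ 2 / 2)) * t ^ (2 * k)) (radialMeasure d α) := by
  have hk : (0 : ℝ) ≤ k := k.cast_nonneg
  have hG : 0 < Real.Gamma (α + 1) := Real.Gamma_pos_of_pos (by linarith)
  have hG' : 0 < Real.Gamma (α + k + 1) := Real.Gamma_pos_of_pos (by linarith)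
  refine .of_integral_ne_zero ?_
  rw [integral_gaussian_pow_radialMeasure hα ha]
  positivity

/-- The Hankel transform of a Gaussian is a Gaussian. The Bessel series is integrated term by term
against the Gaussian; the moments cancel the Gamma factors and leave an exponential series. -/
theorem integral_gaussian_mul_normBessel (hα : -1 / 2 < α) {a : ℝ} (ha : 0 < a) (l : ℝ) :
    ∫ t, Real.exp (-(a * t ^ 2 / 2)) * normBessel α (t * l) ∂(radialMeasure d α) =
      a ^ (-(α + 1)) * Real.exp (-(l ^ 2 / (2 * a))) / (2 * Real.pi) ^ ((d : ℝ) / 2) := by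
  have hG : 0 < Real.Gamma (α + 1) := Real.Gamma_pos_of_pos (by linarith)
  have hG' (k : ℕ) : 0 < Real.Gamma (α + k + 1) := Real.Gamma_pos_of_pos
    (by have : (0 : ℝ) ≤ k := k.cast_nonneg
        linarith)
  set c : ℕ → ℝ := fun k => Real.Gamma (α + 1) * ((-1) ^ k * l ^ (2 * k) /
    (2 ^ (2 * k) * (k.factorial : ℝ) * Real.Gamma (α + k + 1))) with hc
  have hmom (k : ℕ) : ∫ t, c k * (Real.exp (-(a * t ^ 2 / 2)) * t ^ (2 * k)) ∂(radialMeasure d α) =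
      a ^ (-(α + 1)) / (2 * Real.pi) ^ ((d : ℝ) / 2) *
        ((-(l ^ 2 / (2 * a))) ^ k / (k.factorial : ℝ)) := by
    rw [integral_const_mul, integral_gaussian_pow_radialMeasure hα ha, hc]
    have := hG' k
    have e : (2 : ℝ) ^ (2 * k) = 2 ^ k * 2 ^ k := by rw [two_mul, pow_add]
    simp only [neg_pow (l ^ 2 / (2 * a)), div_pow, mul_pow, ← pow_mul, e]
    field_simp
  have habs (k : ℕ) : ∫ t, ‖c k * (Real.exp (-(a * t ^ 2 / 2)) * t ^ (2 * k))‖ ∂(radialMeasure d α)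
      = a ^ (-(α + 1)) / (2 * Real.pi) ^ ((d : ℝ) / 2) *
        ((l ^ 2 / (2 * a)) ^ k / (k.factorial : ℝ)) := by
    have e1 : ∀ t : ℝ, ‖c k * (Real.exp (-(a * t ^ 2 / 2)) * t ^ (2 * k))‖ =
        |c k| * (Real.exp (-(a * t ^ 2 / 2)) * t ^ (2 * k)) := fun t => by
      rw [norm_mul, Real.norm_eq_abs, Real.norm_of_nonneg]
      rw [pow_mul]
      positivity
    have h2 := congrArg abs (hmom k)
    rw [integral_const_mul, abs_mul, abs_of_nonneg (a := ∫ t, _ ∂_)] at h2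
    · simp_rw [e1]
      rw [integral_const_mul, h2, abs_mul, abs_div (_ ^ k), abs_pow, abs_neg, Nat.abs_cast,
        abs_of_nonneg (a := l ^ 2 / (2 * a)) (by positivity),
        abs_of_nonneg (a := a ^ (-(α + 1)) / (2 * Real.pi) ^ ((d : ℝ) / 2)) (by positivity)]
    · refine integral_nonneg fun t => ?_
      simp only [Pi.zero_apply, pow_mul]
      positivity
  have key := hasSum_integral_of_summable_integral_norm (μ := radialMeasure d α)
    (F := fun k t => c k * (Real.exp (-(a * t ^ 2 / 2)) * t ^ (2 * k)))
    (fun k => (integrable_gaussian_pow_radialMeasure hα ha k).const_mul _) (by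
      simp_rw [habs]
      exact (Real.summable_pow_div_factorial _).mul_left _)
  simp_rw [hmom] at key
  have key2 : HasSum (fun k : ℕ => a ^ (-(α + 1)) / (2 * Real.pi) ^ ((d : ℝ) / 2) *
      ((-(l ^ 2 / (2 * a))) ^ k / (k.factorial : ℝ)))
      (a ^ (-(α + 1)) / (2 * Real.pi) ^ ((d : ℝ) / 2) * Real.exp (-(l ^ 2 / (2 * a)))) := by
    refine HasSum.mul_left _ ?_
    rw [Real.exp_eq_exp_ℝ]
    exact NormedSpace.expSeries_div_hasSum_exp _
  rw [mul_div_right_comm, key2.unique key]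
  refine integral_congr_ae (ae_of_all _ fun t => ?_)
  simp only [normBessel, hc]
  rw [← tsum_mul_left, ← tsum_mul_left]
  congr 1
  ext k
  rw [mul_pow]
  ring

/-! ### Gaussians and their Weinstein transforms -/

/-- The function `exp(-|x'|²/2 + i⟨ξ, x'⟩) exp(-a x_{d+1}²/2)`. The width in `x'` is kept fixed;
the frequency `ξ` and the radial parameter `a` suffice for a total family. -/
noncomputable def modulatedGaussian (ξ : EuclideanSpace ℝ (Fin d)) (a : ℝ) (x : WSpace d) : ℂ :=
  Complex.exp (-(1 / 2) * ‖x.1‖ ^ 2 + Complex.I * (inner ℝ ξ x.1 : ℝ)) *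
    (Real.exp (-(a * x.2 ^ 2 / 2)) : ℝ)

/-- The function `exp(-|x' - ξ|²/2) exp(-a x_{d+1}²/2)`. -/
noncomputable def translatedGaussian (ξ : EuclideanSpace ℝ (Fin d)) (a : ℝ) (x : WSpace d) : ℂ :=
  Complex.exp (-(1 / 2) * ‖x.1 - ξ‖ ^ 2) * (Real.exp (-(a * x.2 ^ 2 / 2)) : ℝ)

/-- The transform of a function with separated variables is a Fourier integral times a Hankel
integral. -/
lemma weinsteinIntegral_prod (f : EuclideanSpace ℝ (Fin d) → ℂ) (g : ℝ → ℝ) (y : WSpace d) :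
    weinsteinIntegral α (fun x : WSpace d => f x.1 * (g x.2 : ℂ)) y =
      (∫ v, f v * Complex.exp (-Complex.I * (inner ℝ v y.1 : ℝ))) *
        (∫ t, g t * normBessel α (t * y.2) ∂(radialMeasure d α) : ℝ) := by
  rw [weinsteinIntegral, weinsteinMeasure_eq_prod, ← integral_complex_ofReal, ← integral_prod_mul]
  refine integral_congr_ae (ae_of_all _ fun x => ?_)
  simp only [weinsteinKernel]
  push_cast
  ring

lemma two_pi_cpow (d : ℕ) : ((Real.pi : ℂ) / (1 / 2)) ^ ((d : ℂ) / 2) =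
    (((2 * Real.pi) ^ ((d : ℝ) / 2) : ℝ) : ℂ) := by
  rw [Complex.ofReal_cpow (by positivity)]
  push_cast
  congr 1
  ring

theorem weinsteinIntegral_modulatedGaussian (hα : -1 / 2 < α) (ξ : EuclideanSpace ℝ (Fin d))
    {a : ℝ} (ha : 0 < a) (y : WSpace d) :
    weinsteinIntegral α (modulatedGaussian ξ a) y =
      (a ^ (-(α + 1)) : ℝ) * translatedGaussian ξ (1 / a) y := by
  have hp : (0 : ℝ) < (2 * Real.pi) ^ ((d : ℝ) / 2) := by positivity
  unfold modulatedGaussian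
  rw [weinsteinIntegral_prod
    (fun v => Complex.exp (-(1 / 2) * ‖v‖ ^ 2 + Complex.I * (inner ℝ ξ v : ℝ)))
    (fun t => Real.exp (-(a * t ^ 2 / 2))), integral_gaussian_mul_normBessel hα ha]
  have h := GaussianFourier.integral_cexp_neg_mul_sq_norm_add (b := 1 / 2) (by norm_num)
    Complex.I (ξ - y.1)
  have e : ∀ v : EuclideanSpace ℝ (Fin d),
      Complex.exp (-(1 / 2) * ‖v‖ ^ 2 + Complex.I * (inner ℝ ξ v : ℝ)) *
        Complex.exp (-Complex.I * (inner ℝ v y.1 : ℝ)) =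
      Complex.exp (-(1 / 2) * ‖v‖ ^ 2 + Complex.I * (inner ℝ (ξ - y.1) v : ℝ)) := fun v => by
    rw [← Complex.exp_add, inner_sub_left, real_inner_comm v y.1]
    congr 1
    push_cast
    ring
  simp_rw [e]
  rw [h, finrank_euclideanSpace, Fintype.card_fin, two_pi_cpow, translatedGaussian, norm_sub_rev]
  have e2 : Real.exp (-(1 / a * y.2 ^ 2 / 2)) = Real.exp (-(y.2 ^ 2 / (2 * a))) := by
    congr 1; field_simp
  have e3 : Complex.I ^ 2 * (‖y.1 - ξ‖ : ℂ) ^ 2 / (4 * (1 / 2)) =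
      -(1 / 2) * (‖y.1 - ξ‖ : ℂ) ^ 2 := by
    rw [Complex.I_sq]; ring
  rw [e2, e3]
  have hp' : (((2 * Real.pi) ^ ((d : ℝ) / 2) : ℝ) : ℂ) ≠ 0 := by exact_mod_cast hp.ne'
  rw [Complex.ofReal_div, Complex.ofReal_mul]
  field_simp

theorem weinsteinIntegral_translatedGaussian (hα : -1 / 2 < α) (ξ : EuclideanSpace ℝ (Fin d))
    {a : ℝ} (ha : 0 < a) (y : WSpace d) :
    weinsteinIntegral α (translatedGaussian ξ a) y =
      (a ^ (-(α + 1)) : ℝ) * modulatedGaussian (-ξ) (1 / a) y := by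
  have hp : (0 : ℝ) < (2 * Real.pi) ^ ((d : ℝ) / 2) := by positivity
  unfold translatedGaussian
  rw [weinsteinIntegral_prod (fun v => Complex.exp (-(1 / 2) * ‖v - ξ‖ ^ 2))
    (fun t => Real.exp (-(a * t ^ 2 / 2))), integral_gaussian_mul_normBessel hα ha]
  have h := GaussianFourier.integral_cexp_neg_mul_sq_norm_add (b := 1 / 2) (by norm_num)
    (-Complex.I) y.1
  have e : ∫ v : EuclideanSpace ℝ (Fin d), Complex.exp (-(1 / 2) * ‖v - ξ‖ ^ 2) *
        Complex.exp (-Complex.I * (inner ℝ v y.1 : ℝ)) =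
      Complex.exp (Complex.I * (inner ℝ (-ξ) y.1 : ℝ)) *
        ∫ v : EuclideanSpace ℝ (Fin d),
          Complex.exp (-(1 / 2) * ‖v‖ ^ 2 + -Complex.I * (inner ℝ y.1 v : ℝ)) := by
    rw [← integral_const_mul, ← integral_sub_right_eq_self (fun v => Complex.exp
      (Complex.I * (inner ℝ (-ξ) y.1 : ℝ)) * Complex.exp (-(1 / 2) * ‖v‖ ^ 2 +
        -Complex.I * (inner ℝ y.1 v : ℝ))) ξ]
    refine integral_congr_ae (ae_of_all _ fun v => ?_)
    simp only [← Complex.exp_add]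
    rw [inner_sub_right, inner_neg_left, real_inner_comm v y.1, real_inner_comm ξ y.1]
    congr 1
    push_cast
    ring
  rw [e, h, finrank_euclideanSpace, Fintype.card_fin, two_pi_cpow, modulatedGaussian]
  have e2 : Real.exp (-(1 / a * y.2 ^ 2 / 2)) = Real.exp (-(y.2 ^ 2 / (2 * a))) := by
    congr 1; field_simp
  have e3 : (-Complex.I) ^ 2 * (‖y.1‖ : ℂ) ^ 2 / (4 * (1 / 2)) = -(1 / 2) * (‖y.1‖ : ℂ) ^ 2 := by
    rw [neg_sq, Complex.I_sq]; ring
  rw [e2, e3, Complex.exp_add]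
  have hp' : (((2 * Real.pi) ^ ((d : ℝ) / 2) : ℝ) : ℂ) ≠ 0 := by exact_mod_cast hp.ne'
  rw [Complex.ofReal_div, Complex.ofReal_mul]
  field_simp

lemma continuous_modulatedGaussian (ξ : EuclideanSpace ℝ (Fin d)) (a : ℝ) :
    Continuous (modulatedGaussian ξ a) := by
  unfold modulatedGaussian
  fun_prop

lemma continuous_translatedGaussian (ξ : EuclideanSpace ℝ (Fin d)) (a : ℝ) :
    Continuous (translatedGaussian ξ a) := by
  unfold translatedGaussian
  fun_prop

lemma norm_modulatedGaussian_le (ξ : EuclideanSpace ℝ (Fin d)) {a : ℝ} (ha : 0 < a)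
    (x : WSpace d) : ‖modulatedGaussian ξ a x‖ ≤ 1 := by
  rw [modulatedGaussian, norm_mul, Complex.norm_exp, Complex.norm_real, Real.norm_eq_abs,
    Real.abs_exp, ← Real.exp_add, Real.exp_le_one_iff]
  simp only [Complex.add_re, Complex.mul_re, Complex.I_re, Complex.I_im, Complex.ofReal_re,
    Complex.ofReal_im, ← Complex.ofReal_pow]
  norm_num
  have : 0 ≤ a * x.2 ^ 2 / 2 := by positivity
  nlinarith [sq_nonneg ‖x.1‖]

lemma norm_translatedGaussian_le (ξ : EuclideanSpace ℝ (Fin d)) {a : ℝ} (ha : 0 < a)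
    (x : WSpace d) : ‖translatedGaussian ξ a x‖ ≤ 1 := by
  rw [translatedGaussian, norm_mul, Complex.norm_exp, Complex.norm_real, Real.norm_eq_abs,
    Real.abs_exp, ← Real.exp_add, Real.exp_le_one_iff]
  simp only [Complex.mul_re, Complex.ofReal_re, Complex.ofReal_im, ← Complex.ofReal_pow]
  norm_num
  have : 0 ≤ a * x.2 ^ 2 / 2 := by positivity
  nlinarith [sq_nonneg ‖x.1 - ξ‖]

lemma integrable_radial_gaussian (hα : -1 / 2 < α) {a : ℝ} (ha : 0 < a) :
    Integrable (fun t => (Real.exp (-(a * t ^ 2 / 2)) : ℂ)) (radialMeasure d α) := by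
  have := (integrable_gaussian_pow_radialMeasure (d := d) hα ha 0).ofReal (𝕜 := ℂ)
  simpa using this

lemma integrable_modulatedGaussian (hα : -1 / 2 < α) (ξ : EuclideanSpace ℝ (Fin d)) {a : ℝ}
    (ha : 0 < a) : Integrable (modulatedGaussian ξ a) (weinsteinMeasure d α) := by
  rw [weinsteinMeasure_eq_prod]
  exact (GaussianFourier.integrable_cexp_neg_mul_sq_norm_add (b := 1 / 2) (by norm_num)
    Complex.I ξ).mul_prod (integrable_radial_gaussian hα ha)

lemma integrable_translatedGaussian (hα : -1 / 2 < α) (ξ : EuclideanSpace ℝ (Fin d)) {a : ℝ}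
    (ha : 0 < a) : Integrable (translatedGaussian ξ a) (weinsteinMeasure d α) := by
  rw [weinsteinMeasure_eq_prod]
  have h := GaussianFourier.integrable_cexp_neg_mul_sq_norm_add (b := 1 / 2) (by norm_num)
    0 (0 : EuclideanSpace ℝ (Fin d))
  simp only [zero_mul, add_zero] at h
  exact (h.comp_sub_right ξ).mul_prod (integrable_radial_gaussian hα ha)

/-! ### Interpolation between an `L^p` norm and the supremum norm -/

/-- The interpolation inequality `‖f‖_r^r ≤ ‖f‖_∞^{r-p} ‖f‖_p^p` for `p ≤ r`. -/
lemma lintegral_enorm_rpow_le {X E : Type*} [MeasurableSpace X] [NormedAddCommGroup E]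
    {μ : Measure X} (f : X → E) {p r : ℝ} (hf : eLpNorm f ∞ μ ≠ ∞) (hp : 0 ≤ p)
    (hr : p ≤ r) :
    ∫⁻ x, ‖f x‖ₑ ^ r ∂μ ≤ eLpNorm f ∞ μ ^ (r - p) * ∫⁻ x, ‖f x‖ₑ ^ p ∂μ := by
  rw [← lintegral_const_mul' _ _ (ENNReal.rpow_lt_top_of_nonneg (by linarith) hf).ne]
  refine lintegral_mono_ae ?_
  filter_upwards [ae_le_eLpNormEssSup (f := f) (μ := μ)] with x hx
  rw [← eLpNorm_exponent_top] at hx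
  calc ‖f x‖ₑ ^ r = ‖f x‖ₑ ^ (r - p) * ‖f x‖ₑ ^ p := by
        rw [← ENNReal.rpow_add_of_nonneg _ _ (by linarith) hp, sub_add_cancel]
    _ ≤ _ := by gcongr

lemma MeasureTheory.MemLp.of_exponent_ge {X E : Type*} [MeasurableSpace X] [NormedAddCommGroup E]
    {μ : Measure X} {f : X → E} {p r : ℝ≥0∞} (hp0 : p ≠ 0) (hpr : p ≤ r) (hf : MemLp f p μ)
    (hf' : MemLp f ∞ μ) : MemLp f r μ := by
  rcases eq_or_ne r ∞ with rfl | hr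
  · exact hf'
  have hp : p ≠ ∞ := (hpr.trans_lt hr.lt_top).ne
  have hr0 : r ≠ 0 := fun h => hp0 (le_zero_iff.1 (h ▸ hpr))
  refine ⟨hf.1, (eLpNorm_lt_top_iff_lintegral_rpow_enorm_lt_top hr0 hr).2 ?_⟩
  have hpr' : p.toReal ≤ r.toReal := ENNReal.toReal_mono hr hpr
  refine (lintegral_enorm_rpow_le f hf'.2.ne ENNReal.toReal_nonneg hpr').trans_lt ?_
  refine ENNReal.mul_lt_top (ENNReal.rpow_lt_top_of_nonneg (by linarith) hf'.2.ne) ?_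
  exact (eLpNorm_lt_top_iff_lintegral_rpow_enorm_lt_top hp0 hp).1 hf.2

lemma memLp_modulatedGaussian (hα : -1 / 2 < α) (ξ : EuclideanSpace ℝ (Fin d)) {a : ℝ}
    (ha : 0 < a) {r : ℝ≥0∞} (hr : 1 ≤ r) :
    MemLp (modulatedGaussian ξ a) r (weinsteinMeasure d α) :=
  MemLp.of_exponent_ge one_ne_zero hr
    (memLp_one_iff_integrable.2 (integrable_modulatedGaussian hα ξ ha))
    (memLp_top_of_bound (continuous_modulatedGaussian ξ a).aestronglyMeasurable 1
      (ae_of_all _ (norm_modulatedGaussian_le ξ ha)))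

lemma memLp_translatedGaussian (hα : -1 / 2 < α) (ξ : EuclideanSpace ℝ (Fin d)) {a : ℝ}
    (ha : 0 < a) {r : ℝ≥0∞} (hr : 1 ≤ r) :
    MemLp (translatedGaussian ξ a) r (weinsteinMeasure d α) :=
  MemLp.of_exponent_ge one_ne_zero hr
    (memLp_one_iff_integrable.2 (integrable_translatedGaussian hα ξ ha))
    (memLp_top_of_bound (continuous_translatedGaussian ξ a).aestronglyMeasurable 1
      (ae_of_all _ (norm_translatedGaussian_le ξ ha)))

/-! ### Modulated Gaussians separate functions -/

/-- The product of a character in `x'` and a Laplace kernel in `x_{d+1}²`, that is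
`exp(i⟨ξ, x'⟩) exp(-b x_{d+1}²/2)`. -/
noncomputable def expChar (ξ : EuclideanSpace ℝ (Fin d)) (b : ℝ) (x : WSpace d) : ℂ :=
  Complex.exp (Complex.I * (inner ℝ ξ x.1 : ℝ)) * (Real.exp (-(b * x.2 ^ 2 / 2)) : ℝ)

lemma continuous_expChar (ξ : EuclideanSpace ℝ (Fin d)) (b : ℝ) : Continuous (expChar ξ b) := by
  unfold expChar
  fun_prop

lemma norm_expChar_le (ξ : EuclideanSpace ℝ (Fin d)) {b : ℝ} (hb : 0 ≤ b) (x : WSpace d) :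
    ‖expChar ξ b x‖ ≤ 1 := by
  rw [expChar, norm_mul, Complex.norm_exp, Complex.norm_real, Real.norm_eq_abs, Real.abs_exp,
    ← Real.exp_add, Real.exp_le_one_iff]
  simp only [Complex.mul_re, Complex.I_re, Complex.I_im, Complex.ofReal_re, Complex.ofReal_im]
  have : 0 ≤ b * x.2 ^ 2 / 2 := by positivity
  linarith

lemma expChar_mul_expChar (ξ η : EuclideanSpace ℝ (Fin d)) (b c : ℝ) (x : WSpace d) :
    expChar ξ b x * expChar η c x = expChar (ξ + η) (b + c) x := by
  simp only [expChar]
  rw [mul_mul_mul_comm, ← Complex.exp_add, ← Complex.ofReal_mul, ← Real.exp_add, inner_add_left]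
  push_cast
  ring_nf

lemma star_expChar (ξ : EuclideanSpace ℝ (Fin d)) (b : ℝ) (x : WSpace d) :
    star (expChar ξ b x) = expChar (-ξ) b x := by
  simp only [expChar, Complex.star_def, map_mul, ← Complex.exp_conj, Complex.conj_I,
    Complex.conj_ofReal, inner_neg_left]
  push_cast
  ring_nf

/-- `expChar ξ b` as a bounded continuous function on `ℝ^d × [0, ∞)`. On `ℝ^d × ℝ` these functions
are even in the last variable and would not separate points. -/
noncomputable def expCharBCF (ξ : EuclideanSpace ℝ (Fin d)) (b : ℝ≥0) :
    BoundedContinuousFunction (EuclideanSpace ℝ (Fin d) × ℝ≥0) ℂ :=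
  BoundedContinuousFunction.ofNormedAddCommGroup
    (fun z => expChar ξ (b : ℝ) (z.1, (z.2 : ℝ)))
    ((continuous_expChar ξ b).comp (by fun_prop)) 1
    (fun _ => norm_expChar_le ξ b.2 _)

lemma expCharBCF_apply (ξ : EuclideanSpace ℝ (Fin d)) (b : ℝ≥0)
    (z : EuclideanSpace ℝ (Fin d) × ℝ≥0) : expCharBCF ξ b z = expChar ξ b (z.1, (z.2 : ℝ)) := rfl

lemma expCharBCF_mul (ξ η : EuclideanSpace ℝ (Fin d)) (b c : ℝ≥0) :
    expCharBCF ξ b * expCharBCF η c = expCharBCF (ξ + η) (b + c) := by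
  ext z
  simp only [BoundedContinuousFunction.mul_apply, expCharBCF_apply, NNReal.coe_add,
    expChar_mul_expChar]

lemma star_expCharBCF (ξ : EuclideanSpace ℝ (Fin d)) (b : ℝ≥0) :
    star (expCharBCF ξ b) = expCharBCF (-ξ) b := by
  ext z
  simp only [BoundedContinuousFunction.star_apply, expCharBCF_apply, star_expChar]

/-- The star subalgebra of bounded continuous functions on `ℝ^d × [0, ∞)` generated by the
functions `expCharBCF ξ b`. -/
noncomputable def expCharAlgebra (d : ℕ) :
    StarSubalgebra ℂ (BoundedContinuousFunction (EuclideanSpace ℝ (Fin d) × ℝ≥0) ℂ) where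
  toSubalgebra := Algebra.adjoin ℂ
    (Set.range fun q : EuclideanSpace ℝ (Fin d) × ℝ≥0 => expCharBCF q.1 q.2)
  star_mem' {f} hf := by
    induction hf using Algebra.adjoin_induction with
    | mem f hf =>
      obtain ⟨q, rfl⟩ := hf
      rw [star_expCharBCF]
      exact Algebra.subset_adjoin ⟨(-q.1, q.2), rfl⟩
    | algebraMap r =>
      rw [← algebraMap_star_comm]
      exact Subalgebra.algebraMap_mem _ _
    | add f g _ _ hf hg =>
      rw [star_add]
      exact Subalgebra.add_mem _ hf hg
    | mul f g _ _ hf hg =>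
      rw [star_mul]
      exact Subalgebra.mul_mem _ hg hf

/-- The generators are closed under products and contain `1`, so the algebra is their linear
span. -/
lemma mem_expCharAlgebra_iff
    {g : BoundedContinuousFunction (EuclideanSpace ℝ (Fin d) × ℝ≥0) ℂ} :
    g ∈ expCharAlgebra d ↔ g ∈ Submodule.span ℂ
      (Set.range fun q : EuclideanSpace ℝ (Fin d) × ℝ≥0 => expCharBCF q.1 q.2) := by
  rw [← Algebra.adjoin_eq_span_of_subset]
  · rfl
  · intro f hf
    refine Submodule.subset_span ?_
    induction hf using Submonoid.closure_induction with
    | mem f hf => exact hf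
    | one =>
      refine ⟨(0, 0), ?_⟩
      ext z
      simp [expCharBCF_apply, expChar]
    | mul f g _ _ hf hg =>
      obtain ⟨q, rfl⟩ := hf
      obtain ⟨q', rfl⟩ := hg
      exact ⟨(q.1 + q'.1, q.2 + q'.2), (expCharBCF_mul _ _ _ _).symm⟩

lemma separatesPoints_expCharAlgebra :
    ((expCharAlgebra d).map
      (BoundedContinuousFunction.toContinuousMapStarₐ ℂ)).SeparatesPoints := by
  have hmem : ∀ ξ b, expCharBCF ξ b ∈ expCharAlgebra d := fun ξ b =>
    Algebra.subset_adjoin ⟨(ξ, b), rfl⟩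
  intro z z' hz
  by_cases h2 : z.2 = z'.2
  · have h1 : z.1 ≠ z'.1 := fun h1 => hz (Prod.ext h1 h2)
    -- A frequency along `z.1 - z'.1`, scaled so that the two phases differ by exactly one radian.
    set v := z.1 - z'.1 with hv
    have hv0 : ‖v‖ ≠ 0 := norm_ne_zero_iff.2 (sub_ne_zero.2 h1)
    refine ⟨_, ⟨_, ⟨expCharBCF ((1 / ‖v‖ ^ 2) • v) 0, hmem _ _, rfl⟩, rfl⟩, fun h => ?_⟩
    have h : expCharBCF ((1 / ‖v‖ ^ 2) • v) 0 z = expCharBCF ((1 / ‖v‖ ^ 2) • v) 0 z' := h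
    simp only [expCharBCF_apply, expChar, NNReal.coe_zero, zero_mul, zero_div, neg_zero,
      Real.exp_zero, Complex.ofReal_one, mul_one] at h
    have e : inner ℝ ((1 / ‖v‖ ^ 2) • v) z.1 = 1 + inner ℝ ((1 / ‖v‖ ^ 2) • v) z'.1 := by
      rw [← sub_eq_iff_eq_add, ← inner_sub_right, ← hv, real_inner_smul_left,
        real_inner_self_eq_norm_sq]
      field_simp
    rw [e, Complex.ofReal_add, mul_add, Complex.exp_add, mul_eq_right₀ (Complex.exp_ne_zero _),
      Complex.ofReal_one, mul_one] at h
    have h3 := congrArg Complex.im h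
    rw [← one_mul Complex.I, ← Complex.ofReal_one, Complex.exp_ofReal_mul_I_im] at h3
    have h4 := Real.sin_pos_of_pos_of_lt_pi one_pos (by linarith [Real.pi_gt_three])
    simp at h3
    linarith
  · refine ⟨_, ⟨_, ⟨expCharBCF 0 1, hmem _ _, rfl⟩, rfl⟩, fun h => ?_⟩
    have h : expCharBCF (0 : EuclideanSpace ℝ (Fin d)) 1 z = expCharBCF 0 1 z' := h
    simp only [expCharBCF_apply, expChar, inner_zero_left, Complex.ofReal_zero, mul_zero,
      Complex.exp_zero, one_mul, NNReal.coe_one, Complex.ofReal_inj, Real.exp_eq_exp, neg_inj] at h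
    have h5 : (z.2 : ℝ) ^ 2 = (z'.2 : ℝ) ^ 2 := by linarith
    exact h2 (NNReal.coe_injective ((sq_eq_sq₀ z.2.2 z'.2.2).1 h5))

/-- The positive and negative parts of `r` define finite measures on `ℝ^d × [0, ∞)` with the same
integrals over a separating algebra; hence they agree. -/
lemma ae_eq_zero_of_integral_mul_expChar_eq_zero_real {μ : Measure (WSpace d)}
    (hμ : ∀ᵐ x ∂μ, 0 < x.2) {r : WSpace d → ℝ} (hr : Integrable r μ)
    (h : ∀ (ξ : EuclideanSpace ℝ (Fin d)) (b : ℝ), 0 ≤ b →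
      ∫ x, (r x : ℂ) * expChar ξ b x ∂μ = 0) : r =ᵐ[μ] 0 := by
  set φ : WSpace d → EuclideanSpace ℝ (Fin d) × ℝ≥0 := fun x => (x.1, x.2.toNNReal) with hφ
  have hφm : Measurable φ := by fun_prop
  have hrm : AEMeasurable (fun x => ENNReal.ofReal (r x)) μ := hr.1.aemeasurable.ennreal_ofReal
  have hrm' : AEMeasurable (fun x => ENNReal.ofReal (-r x)) μ :=
    hr.1.aemeasurable.neg.ennreal_ofReal
  set ν := μ.withDensity fun x => ENNReal.ofReal (r x) with hν
  set ν' := μ.withDensity fun x => ENNReal.ofReal (-r x) with hν'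
  have : IsFiniteMeasure ν := isFiniteMeasure_withDensity_ofReal hr.2
  have : IsFiniteMeasure ν' := isFiniteMeasure_withDensity_ofReal hr.neg.2
  have hint : ∀ g : BoundedContinuousFunction (EuclideanSpace ℝ (Fin d) × ℝ≥0) ℂ,
      ∫ z, g z ∂(ν.map φ) - ∫ z, g z ∂(ν'.map φ) = ∫ x, (r x : ℂ) * g (φ x) ∂μ := by
    intro g
    have hgm : AEStronglyMeasurable (fun x => g (φ x)) μ :=
      (g.continuous.measurable.comp hφm).aestronglyMeasurable
    have hi : ∀ s : WSpace d → ℝ, Integrable s μ →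
        Integrable (fun x => (ENNReal.ofReal (s x)).toReal • g (φ x)) μ := fun s hs => by
      have h1 : Integrable (fun x => (ENNReal.ofReal (s x)).toReal) μ := by
        simpa [ENNReal.toReal_ofReal'] using hs.pos_part
      exact h1.smul_bdd ‖g‖ hgm (ae_of_all _ fun x => g.norm_coe_le_norm _)
    rw [integral_map hφm.aemeasurable g.continuous.aestronglyMeasurable,
      integral_map hφm.aemeasurable g.continuous.aestronglyMeasurable, hν, hν',
      integral_withDensity_eq_integral_toReal_smul₀ hrm (ae_of_all _ fun _ => ENNReal.ofReal_lt_top),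
      integral_withDensity_eq_integral_toReal_smul₀ hrm'
        (ae_of_all _ fun _ => ENNReal.ofReal_lt_top),
      ← integral_sub (hi r hr) (hi (fun x => -r x) hr.neg)]
    refine integral_congr_ae (ae_of_all _ fun x => ?_)
    simp only [ENNReal.toReal_ofReal', Complex.real_smul]
    rw [← sub_mul, ← Complex.ofReal_sub, max_zero_sub_max_neg_zero_eq_self]
  have hmap : ν.map φ = ν'.map φ := by
    refine ext_of_forall_mem_subalgebra_integral_eq_of_polish (𝕜 := ℂ)
      separatesPoints_expCharAlgebra fun g hg => ?_
    rw [← sub_eq_zero, hint]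
    rw [mem_expCharAlgebra_iff] at hg
    induction hg using Submodule.span_induction with
    | mem g hg =>
      obtain ⟨q, rfl⟩ := hg
      rw [← h q.1 q.2 q.2.2]
      refine integral_congr_ae ?_
      filter_upwards [hμ] with x hx
      simp [expCharBCF_apply, hφ, hx.le]
    | zero => simp
    | add f g _ _ hf hg =>
      rw [← hint] at hf hg ⊢
      have hi := fun (ρ : Measure (EuclideanSpace ℝ (Fin d) × ℝ≥0)) (_ : IsFiniteMeasure ρ) =>
        integral_add (f.integrable ρ) (g.integrable ρ)
      simp only [BoundedContinuousFunction.add_apply]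
      rw [hi _ inferInstance, hi _ inferInstance, add_sub_add_comm, hf, hg, add_zero]
    | smul c f _ hf =>
      simp only [BoundedContinuousFunction.smul_apply, smul_eq_mul, mul_left_comm _ c]
      rw [integral_const_mul, hf, mul_zero]
  -- The map `φ` is inverted almost everywhere by the inclusion of `[0, ∞)` in `ℝ`.
  have hback : ∀ ρ : Measure (WSpace d), ρ ≪ μ →
      (ρ.map φ).map (fun z => (z.1, (z.2 : ℝ))) = ρ := fun ρ hρ => by
    rw [Measure.map_map (by fun_prop) hφm]
    conv_rhs => rw [← Measure.map_id (μ := ρ)]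
    refine Measure.map_congr ?_
    filter_upwards [hρ.ae_le hμ] with x hx
    simp [hφ, hx.le]
  have hνν' : ν = ν' := by
    rw [← hback ν (withDensity_absolutelyContinuous _ _),
      ← hback ν' (withDensity_absolutelyContinuous _ _), hmap]
  have hfin : ∫⁻ x, ENNReal.ofReal (r x) ∂μ ≠ ∞ := by
    have := measure_ne_top ν Set.univ
    rwa [hν, withDensity_apply _ MeasurableSet.univ, Measure.restrict_univ] at this
  have := (withDensity_eq_iff hrm hrm' hfin).1 hνν'
  filter_upwards [this] with x hx
  rcases le_total 0 (r x) with h0 | h0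
  · rw [ENNReal.ofReal_of_nonpos (neg_nonpos.2 h0), ENNReal.ofReal_eq_zero] at hx
    exact le_antisymm hx h0
  · rw [ENNReal.ofReal_of_nonpos h0, eq_comm, ENNReal.ofReal_eq_zero] at hx
    exact le_antisymm h0 (neg_nonpos.1 hx)

lemma ae_eq_zero_of_integral_mul_expChar_eq_zero {μ : Measure (WSpace d)}
    (hμ : ∀ᵐ x ∂μ, 0 < x.2) {v : WSpace d → ℂ} (hv : Integrable v μ)
    (h : ∀ (ξ : EuclideanSpace ℝ (Fin d)) (b : ℝ), 0 ≤ b →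
      ∫ x, v x * expChar ξ b x ∂μ = 0) : v =ᵐ[μ] 0 := by
  have hi : ∀ {u : WSpace d → ℂ}, Integrable u μ → ∀ (ξ : EuclideanSpace ℝ (Fin d)) (b : ℝ),
      0 ≤ b → Integrable (fun x => u x * expChar ξ b x) μ := fun hu ξ b hb =>
    hu.mul_bdd (continuous_expChar ξ b).aestronglyMeasurable
      (ae_of_all _ (norm_expChar_le ξ hb))
  have hvs : Integrable (fun x => star (v x)) μ :=
    (Complex.conjCLE : ℂ →L[ℝ] ℂ).integrable_comp hv
  have hs : ∀ (ξ : EuclideanSpace ℝ (Fin d)) (b : ℝ), 0 ≤ b →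
      ∫ x, star (v x) * expChar ξ b x ∂μ = 0 := fun ξ b hb => by
    have h1 := congrArg (starRingEnd ℂ) (h (-ξ) b hb)
    rw [← integral_conj, map_zero] at h1
    rw [← h1]
    refine integral_congr_ae (ae_of_all _ fun x => ?_)
    have := star_expChar (-ξ) b x
    rw [neg_neg] at this
    simp only [map_mul, ← this]
    rfl
  have hre := ae_eq_zero_of_integral_mul_expChar_eq_zero_real hμ hv.re fun ξ b hb => by
    have h1 : ∀ x, ((RCLike.re (v x) : ℝ) : ℂ) * expChar ξ b x =
        1 / 2 * (v x * expChar ξ b x + star (v x) * expChar ξ b x) := fun x => by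
      have : ((RCLike.re (v x) : ℝ) : ℂ) = (v x + star (v x)) / 2 :=
        Complex.re_eq_add_conj (v x)
      rw [this]
      ring
    simp_rw [h1]
    rw [integral_const_mul, integral_add (hi hv ξ b hb) (hi hvs ξ b hb), h ξ b hb, hs ξ b hb]
    simp
  have him := ae_eq_zero_of_integral_mul_expChar_eq_zero_real hμ hv.im fun ξ b hb => by
    have h1 : ∀ x, ((RCLike.im (v x) : ℝ) : ℂ) * expChar ξ b x =
        1 / (2 * Complex.I) * (v x * expChar ξ b x - star (v x) * expChar ξ b x) := fun x => by
      have : ((RCLike.im (v x) : ℝ) : ℂ) = (v x - star (v x)) / (2 * Complex.I) :=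
        Complex.im_eq_sub_conj (v x)
      rw [this]
      ring
    simp_rw [h1]
    rw [integral_const_mul, integral_sub (hi hv ξ b hb) (hi hvs ξ b hb), h ξ b hb, hs ξ b hb]
    simp
  filter_upwards [hre, him] with x h1 h2
  exact Complex.ext h1 h2

lemma modulatedGaussian_mul_expChar (ξ : EuclideanSpace ℝ (Fin d)) (b : ℝ) (x : WSpace d) :
    modulatedGaussian 0 1 x * expChar ξ b x = modulatedGaussian ξ (1 + b) x := by
  simp only [modulatedGaussian, expChar]
  rw [mul_mul_mul_comm, ← Complex.exp_add, ← Complex.ofReal_mul, ← Real.exp_add, inner_zero_left]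
  push_cast
  ring_nf

/-- The modulated Gaussians separate: a function orthogonal to all of them vanishes. It is used
both for the inversion formula and for the density of their span in `L²`. -/
theorem ae_eq_zero_of_integral_mul_modulatedGaussian_eq_zero {w : WSpace d → ℂ}
    (hw : Integrable (fun x => w x * modulatedGaussian 0 1 x) (weinsteinMeasure d α))
    (h : ∀ (ξ : EuclideanSpace ℝ (Fin d)) (a : ℝ), 0 < a →
      ∫ x, w x * modulatedGaussian ξ a x ∂(weinsteinMeasure d α) = 0) :
    w =ᵐ[weinsteinMeasure d α] 0 := by
  have := ae_eq_zero_of_integral_mul_expChar_eq_zero ae_pos_weinsteinMeasure hw fun ξ b hb => by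
    simp_rw [mul_assoc, modulatedGaussian_mul_expChar]
    exact h ξ (1 + b) (by linarith)
  filter_upwards [this] with x hx
  refine (mul_eq_zero.1 hx).resolve_right ?_
  simp [modulatedGaussian]

/-! ### The duality identity for transform pairs -/

lemma tendsto_integral_mul_of_tendsto_eLpNorm {X : Type*} [MeasurableSpace X] {μ : Measure X}
    {p q : ℝ≥0∞} [ENNReal.HolderConjugate q p] {v : ℕ → X → ℂ} {g k : X → ℂ}
    (hv : ∀ n, AEStronglyMeasurable (v n) μ) (hg : MemLp g q μ) (hk : MemLp k p μ)
    (hvk : ∀ n, Integrable (fun x => v n x * k x) μ)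
    (h : Tendsto (fun n => eLpNorm (v n - g) q μ) atTop (𝓝 0)) :
    Tendsto (fun n => ∫ x, v n x * k x ∂μ) atTop (𝓝 (∫ x, g x * k x ∂μ)) := by
  have hgk : Integrable (fun x => g x * k x) μ := hg.integrable_mul hk
  rw [tendsto_iff_edist_tendsto_0]
  have h0 : Tendsto (fun n => eLpNorm (v n - g) q μ * eLpNorm k p μ) atTop (𝓝 0) := by
    simpa using ENNReal.Tendsto.mul_const h (Or.inr hk.2.ne)
  refine tendsto_of_tendsto_of_tendsto_of_le_of_le tendsto_const_nhds h0
    (fun _ => zero_le) fun n => ?_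
  simp only
  rw [edist_eq_enorm_sub, ← integral_sub (hvk n) hgk]
  refine (enorm_integral_le_lintegral_enorm _).trans ?_
  have := eLpNorm_smul_le_mul_eLpNorm (p := q) (q := p) (r := 1) hk.1 ((hv n).sub hg.1)
  rw [eLpNorm_one_eq_lintegral_enorm] at this
  refine le_trans (le_of_eq ?_) this
  refine lintegral_congr fun x => ?_
  simp [sub_mul]

/-- The symmetry of the transform passes to the extension to `L^p`: both sides are continuous
under the two limits in the definition of the extension, by Hölder's inequality. Boundedness of
the transform from `L^p` to `L^q` is not needed, as convergence of the transforms in `L^q` is part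
of the definition. -/
theorem IsWeinsteinTransform.integral_mul_eq (hα : -1 / 2 < α) {p : ℝ≥0∞} (hp : 1 ≤ p)
    {f g k : WSpace d → ℂ} (hfg : IsWeinsteinTransform α p f g)
    (hk1 : Integrable k (weinsteinMeasure d α)) (hkp : MemLp k p (weinsteinMeasure d α))
    (hFk : MemLp (weinsteinIntegral α k) (ENNReal.conjExponent p) (weinsteinMeasure d α)) :
    ∫ y, g y * k y ∂(weinsteinMeasure d α) =
      ∫ x, f x * weinsteinIntegral α k x ∂(weinsteinMeasure d α) := by
  have := ENNReal.HolderConjugate.conjExponent hp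
  have := ENNReal.HolderConjugate.symm (p := p) (q := ENNReal.conjExponent p)
  obtain ⟨hf, hg, u, hu1, hup, huf, hug⟩ := hfg
  have hu1' := fun n => memLp_one_iff_integrable.1 (hu1 n)
  have h1 := tendsto_integral_mul_of_tendsto_eLpNorm
    (fun n => (continuous_weinsteinIntegral hα (hu1' n)).aestronglyMeasurable) hg hkp
    (fun n => hk1.bdd_mul (continuous_weinsteinIntegral hα (hu1' n)).aestronglyMeasurable
      (ae_of_all _ (norm_weinsteinIntegral_le hα (hu1' n)))) hug
  have h2 := tendsto_integral_mul_of_tendsto_eLpNorm (fun n => (hup n).1) hf hFk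
    (fun n => (hup n).integrable_mul hFk) huf
  simp_rw [integral_weinsteinIntegral_mul hα (hu1' _) hk1] at h1
  exact tendsto_nhds_unique h1 h2

/-! ### Inversion -/

lemma star_modulatedGaussian (ξ : EuclideanSpace ℝ (Fin d)) (a : ℝ) (x : WSpace d) :
    star (modulatedGaussian ξ a x) = modulatedGaussian (-ξ) a x := by
  simp only [modulatedGaussian, Complex.star_def, map_mul, ← Complex.exp_conj, map_add, map_neg,
    map_div₀, map_one, map_pow, Complex.conj_I, Complex.conj_ofReal, inner_neg_left, map_ofNat]
  push_cast
  ring_nf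

lemma star_translatedGaussian (ξ : EuclideanSpace ℝ (Fin d)) (a : ℝ) (x : WSpace d) :
    star (translatedGaussian ξ a x) = translatedGaussian ξ a x := by
  simp only [translatedGaussian, Complex.star_def, map_mul, ← Complex.exp_conj, map_neg,
    map_div₀, map_one, map_pow, Complex.conj_ofReal, map_ofNat]

lemma weinsteinIntegral_modulatedGaussian_eq_smul (hα : -1 / 2 < α)
    (ξ : EuclideanSpace ℝ (Fin d)) {a : ℝ} (ha : 0 < a) :
    weinsteinIntegral α (modulatedGaussian ξ a) =
      ((a ^ (-(α + 1)) : ℝ) : ℂ) • translatedGaussian ξ (1 / a) :=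
  funext fun y => weinsteinIntegral_modulatedGaussian hα ξ ha y

/-- Inversion on modulated Gaussians: the transform applied twice is the reflection `x' ↦ -x'`. -/
lemma weinsteinIntegral_weinsteinIntegral_modulatedGaussian (hα : -1 / 2 < α)
    (ξ : EuclideanSpace ℝ (Fin d)) {a : ℝ} (ha : 0 < a) :
    weinsteinIntegral α (weinsteinIntegral α (modulatedGaussian ξ a)) =
      modulatedGaussian (-ξ) a := by
  ext y
  rw [weinsteinIntegral_modulatedGaussian_eq_smul hα ξ ha]
  have h : weinsteinIntegral α (((a ^ (-(α + 1)) : ℝ) : ℂ) • translatedGaussian ξ (1 / a)) y =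
      ((a ^ (-(α + 1)) : ℝ) : ℂ) * weinsteinIntegral α (translatedGaussian ξ (1 / a)) y := by
    simp only [weinsteinIntegral, Pi.smul_apply, smul_eq_mul, mul_assoc]
    exact integral_const_mul _ _
  rw [h, weinsteinIntegral_translatedGaussian hα ξ (by positivity), ← mul_assoc,
    ← Complex.ofReal_mul, ← Real.mul_rpow ha.le (by positivity), mul_one_div_cancel ha.ne',
    Real.one_rpow, one_div_one_div]
  simp

lemma star_weinsteinIntegral_modulatedGaussian (hα : -1 / 2 < α)
    (ξ : EuclideanSpace ℝ (Fin d)) {a : ℝ} (ha : 0 < a) (x : WSpace d) :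
    star (weinsteinIntegral α (modulatedGaussian ξ a) x) =
      weinsteinIntegral α (modulatedGaussian ξ a) x := by
  rw [weinsteinIntegral_modulatedGaussian hα ξ ha, star_mul', star_translatedGaussian,
    Complex.star_def, Complex.conj_ofReal]

lemma memLp_weinsteinIntegral_modulatedGaussian (hα : -1 / 2 < α)
    (ξ : EuclideanSpace ℝ (Fin d)) {a : ℝ} (ha : 0 < a) {r : ℝ≥0∞} (hr : 1 ≤ r) :
    MemLp (weinsteinIntegral α (modulatedGaussian ξ a)) r (weinsteinMeasure d α) := by
  rw [weinsteinIntegral_modulatedGaussian_eq_smul hα ξ ha]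
  exact (memLp_translatedGaussian hα ξ (by positivity) hr).const_smul _

/-- Inversion formula: if the transform `g` of `f ∈ L^p` is integrable, then `f` is the integral
of `g` against the conjugate kernel. Both sides have the same integrals against every modulated
Gaussian. -/
theorem IsWeinsteinTransform.ae_eq_star_weinsteinIntegral (hα : -1 / 2 < α) {p : ℝ≥0∞}
    (hp : 1 ≤ p) {f g : WSpace d → ℂ} (hfg : IsWeinsteinTransform α p f g)
    (hg : Integrable g (weinsteinMeasure d α)) :
    f =ᵐ[weinsteinMeasure d α] fun x => star (weinsteinIntegral α (fun y => star (g y)) x) := by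
  have := ENNReal.HolderConjugate.conjExponent hp
  have hq : 1 ≤ ENNReal.conjExponent p :=
    ENNReal.HolderConjugate.one_le (ENNReal.conjExponent p) p
  have hgs : Integrable (fun y => star (g y)) (weinsteinMeasure d α) :=
    (Complex.conjCLE : ℂ →L[ℝ] ℂ).integrable_comp hg
  set Ψ : WSpace d → ℂ := fun x => star (weinsteinIntegral α (fun y => star (g y)) x) with hΨ
  have hΨc : Continuous Ψ := (continuous_weinsteinIntegral hα hgs).star
  have hfi (ξ : EuclideanSpace ℝ (Fin d)) {a : ℝ} (ha : 0 < a) :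
      Integrable (fun x => f x * modulatedGaussian ξ a x) (weinsteinMeasure d α) :=
    hfg.1.integrable_mul (memLp_modulatedGaussian hα ξ ha hq)
  have hΨi (ξ : EuclideanSpace ℝ (Fin d)) {a : ℝ} (ha : 0 < a) :
      Integrable (fun x => Ψ x * modulatedGaussian ξ a x) (weinsteinMeasure d α) :=
    (integrable_modulatedGaussian hα ξ ha).bdd_mul hΨc.aestronglyMeasurable
      (ae_of_all _ fun x => (norm_star _).trans_le (norm_weinsteinIntegral_le hα hgs x))
  -- Each modulated Gaussian is the transform of the transform of its conjugate, so that the duality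
  -- identity turns its integrals against `f` into integrals of `g`, and Fubini into those of `Ψ`.
  have key : (fun x => f x - Ψ x) =ᵐ[weinsteinMeasure d α] 0 := by
    refine ae_eq_zero_of_integral_mul_modulatedGaussian_eq_zero ?_ fun ξ a ha => ?_
    · simp_rw [sub_mul]
      exact (hfi 0 one_pos).sub (hΨi 0 one_pos)
    · simp_rw [sub_mul]
      rw [integral_sub (hfi ξ ha) (hΨi ξ ha), sub_eq_zero]
      have h1 := hfg.integral_mul_eq hα hp
        (memLp_one_iff_integrable.1 (memLp_weinsteinIntegral_modulatedGaussian hα (-ξ) ha le_rfl))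
        (memLp_weinsteinIntegral_modulatedGaussian hα (-ξ) ha hp)
        (by
          rw [weinsteinIntegral_weinsteinIntegral_modulatedGaussian hα _ ha]
          exact memLp_modulatedGaussian hα _ ha hq)
      rw [weinsteinIntegral_weinsteinIntegral_modulatedGaussian hα _ ha, neg_neg] at h1
      rw [← h1]
      have h2 := congrArg (starRingEnd ℂ) (integral_weinsteinIntegral_mul hα hgs
        (integrable_modulatedGaussian hα (-ξ) ha))
      rw [← integral_conj, ← integral_conj] at h2
      calc _ = _ := ?_
        _ = _ := h2.symm
        _ = _ := ?_
      · refine integral_congr_ae (ae_of_all _ fun x => ?_)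
        have := star_weinsteinIntegral_modulatedGaussian hα (-ξ) ha x
        rw [Complex.star_def] at this
        simp [this]
      · refine integral_congr_ae (ae_of_all _ fun x => ?_)
        have := star_modulatedGaussian (-ξ) a x
        rw [Complex.star_def, neg_neg] at this
        simp [this, hΨ]
  filter_upwards [key] with x hx
  exact sub_eq_zero.1 hx

/-! ### Energy inequality -/

/-- If the families `e` and `f` have the same Gram matrix, `e` is total, and `y` has the same
coefficients along `f` as `x` has along `e`, then `‖x‖ ≤ ‖y‖`: the map `e i ↦ f i` is an isometry,
and `x` is the image of `y` under its adjoint. -/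
lemma norm_le_of_inner_eq {ι E F : Type*} [NormedAddCommGroup E] [InnerProductSpace ℂ E]
    [CompleteSpace E] [NormedAddCommGroup F] [InnerProductSpace ℂ F] {e : ι → E} {f : ι → F}
    (hef : ∀ i j, inner ℂ (e i) (e j) = inner ℂ (f i) (f j))
    (htot : ∀ z : E, (∀ i, inner ℂ (e i) z = 0) → z = 0) {x : E} {y : F}
    (hxy : ∀ i, inner ℂ (e i) x = inner ℂ (f i) y) : ‖x‖ ≤ ‖y‖ := by
  have h1 (c : ι →₀ ℂ) : inner ℂ (Finsupp.linearCombination ℂ e c) x =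
      inner ℂ (Finsupp.linearCombination ℂ f c) y := by
    simp only [Finsupp.linearCombination_apply, Finsupp.sum, sum_inner, inner_smul_left, hxy]
  have h2 (c : ι →₀ ℂ) :
      ‖Finsupp.linearCombination ℂ e c‖ = ‖Finsupp.linearCombination ℂ f c‖ := by
    rw [norm_eq_sqrt_re_inner (𝕜 := ℂ), norm_eq_sqrt_re_inner (𝕜 := ℂ)]
    simp only [Finsupp.linearCombination_apply, Finsupp.sum, sum_inner, inner_sum,
      inner_smul_left, inner_smul_right, hef]
  have hcl : IsClosed {z : E | ‖inner ℂ z x‖ ≤ ‖z‖ * ‖y‖} :=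
    isClosed_le (by fun_prop) (by fun_prop)
  have hdense : (Submodule.span ℂ (Set.range e)).topologicalClosure = ⊤ := by
    rw [Submodule.topologicalClosure_eq_top_iff, Submodule.eq_bot_iff]
    exact fun z hz => htot z fun i =>
      (Submodule.mem_orthogonal _ z).1 hz _ (Submodule.subset_span ⟨i, rfl⟩)
  have hsub : ((Submodule.span ℂ (Set.range e)).topologicalClosure : Set E) ⊆
      {z : E | ‖inner ℂ z x‖ ≤ ‖z‖ * ‖y‖} := by
    refine closure_minimal (fun z hz => ?_) hcl
    obtain ⟨c, rfl⟩ := (Finsupp.mem_span_range_iff_exists_finsupp).1 hz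
    have h3 := norm_inner_le_norm (𝕜 := ℂ) (Finsupp.linearCombination ℂ f c) y
    rwa [← h1, ← h2] at h3
  have hx : ‖inner ℂ x x‖ ≤ ‖x‖ * ‖y‖ := hsub (hdense ▸ Submodule.mem_top)
  rw [← inner_self_re_eq_norm, inner_self_eq_norm_mul_norm] at hx
  rcases (norm_nonneg x).eq_or_lt with h0 | h0
  · rw [← h0]
    exact norm_nonneg y
  · exact le_of_mul_le_mul_left hx h0

/-- Half of Plancherel's theorem for a transform pair that lies in `L²` on both sides. -/
theorem IsWeinsteinTransform.eLpNorm_two_le (hα : -1 / 2 < α) {p : ℝ≥0∞} (hp : 1 ≤ p)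
    {f g : WSpace d → ℂ} (hfg : IsWeinsteinTransform α p f g)
    (hf2 : MemLp f 2 (weinsteinMeasure d α)) (hg2 : MemLp g 2 (weinsteinMeasure d α)) :
    eLpNorm g 2 (weinsteinMeasure d α) ≤ eLpNorm f 2 (weinsteinMeasure d α) := by
  have := ENNReal.HolderConjugate.conjExponent hp
  have hq : 1 ≤ ENNReal.conjExponent p :=
    ENNReal.HolderConjugate.one_le (ENNReal.conjExponent p) p
  have hone : (1 : ℝ≥0∞) ≤ 2 := one_le_two
  have hM := fun i : EuclideanSpace ℝ (Fin d) × Set.Ioi (0 : ℝ) =>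
    memLp_modulatedGaussian hα i.1 i.2.2 hone
  have hN := fun i : EuclideanSpace ℝ (Fin d) × Set.Ioi (0 : ℝ) =>
    memLp_weinsteinIntegral_modulatedGaussian hα (-i.1) i.2.2 hone
  have hinner : ∀ {u v : WSpace d → ℂ} (hu : MemLp u 2 (weinsteinMeasure d α))
      (hv : MemLp v 2 (weinsteinMeasure d α)),
      inner ℂ (hu.toLp u) (hv.toLp v) = ∫ x, star (u x) * v x ∂(weinsteinMeasure d α) := by
    intro u v hu hv
    rw [L2.inner_def]
    refine integral_congr_ae ?_
    filter_upwards [hu.coeFn_toLp, hv.coeFn_toLp] with x h1 h2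
    rw [h1, h2, RCLike.inner_apply, mul_comm]
    rfl
  have key : ‖hg2.toLp g‖ ≤ ‖hf2.toLp f‖ := by
    refine norm_le_of_inner_eq (e := fun i => (hM i).toLp _) (f := fun i => (hN i).toLp _)
      (fun i j => ?_) (fun z hz => ?_) (fun i => ?_)
    · rw [hinner, hinner]
      simp_rw [star_modulatedGaussian, star_weinsteinIntegral_modulatedGaussian hα _ i.2.2]
      rw [integral_weinsteinIntegral_mul hα (integrable_modulatedGaussian hα _ i.2.2)
        (memLp_one_iff_integrable.1
          (memLp_weinsteinIntegral_modulatedGaussian hα (-j.1) j.2.2 le_rfl)),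
        weinsteinIntegral_weinsteinIntegral_modulatedGaussian hα _ j.2.2, neg_neg]
    · have hz2 := Lp.memLp z
      have h0 : (z : WSpace d → ℂ) =ᵐ[weinsteinMeasure d α] 0 := by
        refine ae_eq_zero_of_integral_mul_modulatedGaussian_eq_zero
          (hz2.integrable_mul (memLp_modulatedGaussian hα 0 one_pos hone)) fun ξ a ha => ?_
        have h1 := hz (-ξ, ⟨a, ha⟩)
        rw [← Lp.toLp_coeFn z hz2, hinner] at h1
        simp_rw [star_modulatedGaussian, neg_neg] at h1
        rw [← h1]
        exact integral_congr_ae (ae_of_all _ fun x => mul_comm _ _)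
      exact (Lp.eq_zero_iff_ae_eq_zero).2 h0
    · rw [hinner, hinner]
      simp_rw [star_modulatedGaussian, star_weinsteinIntegral_modulatedGaussian hα _ i.2.2]
      have h1 := hfg.integral_mul_eq hα hp (integrable_modulatedGaussian hα (-i.1) i.2.2)
        (memLp_modulatedGaussian hα (-i.1) i.2.2 hp)
        (memLp_weinsteinIntegral_modulatedGaussian hα (-i.1) i.2.2 hq)
      simp_rw [mul_comm (modulatedGaussian _ _ _), h1, mul_comm (f _)]
  rw [Lp.norm_toLp, Lp.norm_toLp] at key
  exact (ENNReal.toReal_le_toReal hg2.2.ne hf2.2.ne).1 key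

/-! ### Bandlimited functions -/

/-- The absorption step: with `A = ‖ψ‖_∞`, `B = ‖ψ‖_p`, `I = ‖ψ‖_2²` and `m` the measure of the
frequency set, the power `A^{2-p}` is cancelled, which is why `A` has to be finite beforehand. -/
lemma ENNReal.le_rpow_mul_of_le_rpow_half_mul {A B m I : ℝ≥0∞} {p : ℝ} (hp1 : 1 ≤ p) (hp2 : p ≤ 2)
    (hA : A ≠ ∞) (h1 : A ≤ m ^ (1 / 2 : ℝ) * I ^ (1 / 2 : ℝ)) (h2 : I ≤ A ^ (2 - p) * B ^ p) :
    A ≤ m ^ (1 / p) * B := by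
  have hp0 : 0 < p := by linarith
  rcases eq_or_ne A 0 with rfl | hA0
  · exact zero_le
  have h3 : A ^ (2 : ℝ) ≤ m * I := by
    have := ENNReal.rpow_le_rpow h1 (zero_le_two : (0 : ℝ) ≤ 2)
    rwa [ENNReal.mul_rpow_of_nonneg _ _ zero_le_two, ← ENNReal.rpow_mul, ← ENNReal.rpow_mul,
      one_div_mul_cancel two_ne_zero, ENNReal.rpow_one, ENNReal.rpow_one] at this
  have h4 : A ^ (2 - p) * A ^ p ≤ A ^ (2 - p) * (m * B ^ p) := by
    rw [← ENNReal.rpow_add_of_nonneg _ _ (by linarith) hp0.le, sub_add_cancel]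
    calc A ^ (2 : ℝ) ≤ m * I := h3
      _ ≤ m * (A ^ (2 - p) * B ^ p) := by gcongr
      _ = _ := by ring
  have h5 : A ^ p ≤ m * B ^ p := by
    refine (ENNReal.mul_le_mul_iff_right ?_ ?_).1 h4
    · exact (ENNReal.rpow_pos (pos_iff_ne_zero.2 hA0) hA).ne'
    · exact (ENNReal.rpow_lt_top_of_nonneg (by linarith) hA).ne
  have h6 := ENNReal.rpow_le_rpow h5 (z := 1 / p) (by positivity)
  rwa [ENNReal.mul_rpow_of_nonneg _ _ (by positivity), ← ENNReal.rpow_mul, ← ENNReal.rpow_mul,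
    mul_one_div_cancel hp0.ne', ENNReal.rpow_one, ENNReal.rpow_one] at h6

lemma two_le_conjExponent {p : ℝ≥0∞} (hp2 : p ≤ 2) : 2 ≤ ENNReal.conjExponent p := by
  have h1 : p - 1 ≤ 1 := by
    rw [tsub_le_iff_right, one_add_one_eq_two]
    exact hp2
  rw [ENNReal.conjExponent, ← one_add_one_eq_two]
  gcongr
  exact ENNReal.one_le_inv.2 h1

/-- A function bandlimited to a set of finite measure is bounded, with the sharp constant. -/
theorem IsBandlimited.eLpNorm_top_le (hα : -1 / 2 < α) {p : ℝ≥0∞} (hp1 : 1 ≤ p) (hp2 : p ≤ 2)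
    {S : Set (WSpace d)} (hS : MeasurableSet S) (hSfin : weinsteinMeasure d α S ≠ ∞)
    {ψ : WSpace d → ℂ} (hψ : IsBandlimited α p S ψ) :
    eLpNorm ψ ∞ (weinsteinMeasure d α) ≤
      weinsteinMeasure d α S ^ (1 / p.toReal) * eLpNorm ψ p (weinsteinMeasure d α) := by
  have hptop : p ≠ ∞ := (hp2.trans_lt ENNReal.ofNat_lt_top).ne
  have hp0 : p ≠ 0 := (one_pos.trans_le hp1).ne'
  obtain ⟨hψp, g, -, hG⟩ := hψ
  set G := S.indicator g with hGdef
  have : IsFiniteMeasure ((weinsteinMeasure d α).restrict S) :=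
    isFiniteMeasure_restrict.2 hSfin
  have hres : MemLp g (ENNReal.conjExponent p) ((weinsteinMeasure d α).restrict S) :=
    (memLp_indicator_iff_restrict hS).1 hG.2.1
  -- `G` lies in `L^q` with `q ≥ 2` and is carried by a set of finite measure.
  have hG2 : MemLp G 2 (weinsteinMeasure d α) :=
    (memLp_indicator_iff_restrict hS).2 (hres.mono_exponent (two_le_conjExponent hp2))
  have hG1 : MemLp G 1 (weinsteinMeasure d α) :=
    (memLp_indicator_iff_restrict hS).2
      (hres.mono_exponent (one_le_two.trans (two_le_conjExponent hp2)))
  have hGs : Integrable (fun y => star (G y)) (weinsteinMeasure d α) :=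
    (Complex.conjCLE : ℂ →L[ℝ] ℂ).integrable_comp (memLp_one_iff_integrable.1 hG1)
  have hψG := hG.ae_eq_star_weinsteinIntegral hα hp1 (memLp_one_iff_integrable.1 hG1)
  have hsup : eLpNorm ψ ∞ (weinsteinMeasure d α) ≤ eLpNorm G 1 (weinsteinMeasure d α) := by
    rw [eLpNorm_exponent_top, eLpNorm_one_eq_lintegral_enorm]
    refine eLpNormEssSup_le_of_ae_enorm_bound ?_
    filter_upwards [hψG] with x hx
    have h := norm_weinsteinIntegral_le hα hGs x
    rw [hx, ← ofReal_norm, norm_star]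
    refine (ENNReal.ofReal_le_ofReal h).trans_eq ?_
    rw [ofReal_integral_norm_eq_lintegral_enorm hGs]
    exact lintegral_congr fun y => by rw [← ofReal_norm, norm_star, ofReal_norm]
  have hG12 : eLpNorm G 1 (weinsteinMeasure d α) ≤
      weinsteinMeasure d α S ^ (1 / 2 : ℝ) * eLpNorm G 2 (weinsteinMeasure d α) := by
    have h := eLpNorm_le_eLpNorm_mul_rpow_measure_univ (p := 1) (q := 2) one_le_two hres.1
    rw [← eLpNorm_indicator_eq_eLpNorm_restrict hS, ← eLpNorm_indicator_eq_eLpNorm_restrict hS,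
      Measure.restrict_apply_univ, mul_comm] at h
    convert! h using 3
    norm_num
  have htop : MemLp ψ ∞ (weinsteinMeasure d α) := ⟨hψp.1, hsup.trans_lt hG1.2⟩
  have hψ2 : MemLp ψ 2 (weinsteinMeasure d α) := MemLp.of_exponent_ge hp0 hp2 hψp htop
  have hpr1 : 1 ≤ p.toReal := by simpa using ENNReal.toReal_mono hptop hp1
  have hpr2 : p.toReal ≤ 2 := by simpa using ENNReal.toReal_mono ENNReal.ofNat_ne_top hp2
  refine ENNReal.le_rpow_mul_of_le_rpow_half_mul
    (I := ∫⁻ x, ‖ψ x‖ₑ ^ (2 : ℝ) ∂(weinsteinMeasure d α)) hpr1 hpr2 htop.2.ne ?_ ?_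
  · refine hsup.trans (hG12.trans ?_)
    gcongr
    refine (hG.eLpNorm_two_le hα hp1 hψ2 hG2).trans_eq ?_
    rw [eLpNorm_eq_lintegral_rpow_enorm_toReal two_ne_zero ENNReal.ofNat_ne_top]
    simp
  · refine (lintegral_enorm_rpow_le ψ htop.2.ne ENNReal.toReal_nonneg hpr2).trans_eq ?_
    rw [eLpNorm_eq_lintegral_rpow_enorm_toReal hp0 hptop, ← ENNReal.rpow_mul,
      one_div_mul_cancel (by linarith), ENNReal.rpow_one]

theorem IsBandlimited.eLpNorm_timeLimit_le (hα : -1 / 2 < α) {p : ℝ≥0∞} (hp1 : 1 ≤ p)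
    (hp2 : p ≤ 2) {Ω S : Set (WSpace d)} (hΩ : MeasurableSet Ω) (hS : MeasurableSet S)
    {ψ : WSpace d → ℂ} (hψ : IsBandlimited α p S ψ) :
    eLpNorm (timeLimit Ω ψ) p (weinsteinMeasure d α) ≤
      weinsteinMeasure d α S ^ (1 / p.toReal) * weinsteinMeasure d α Ω ^ (1 / p.toReal) *
        eLpNorm ψ p (weinsteinMeasure d α) := by
  have hptop : p ≠ ∞ := (hp2.trans_lt ENNReal.ofNat_lt_top).ne
  have hpr : 0 < 1 / p.toReal :=
    one_div_pos.2 (ENNReal.toReal_pos (one_pos.trans_le hp1).ne' hptop)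
  have hrestrict : eLpNorm (timeLimit Ω ψ) p (weinsteinMeasure d α) =
      eLpNorm ψ p ((weinsteinMeasure d α).restrict Ω) :=
    eLpNorm_indicator_eq_eLpNorm_restrict hΩ
  -- If `S` has infinite measure, either the right-hand side is `∞` or the left-hand side is `0`.
  rcases eq_or_ne (weinsteinMeasure d α S) ∞ with hSt | hSt
  · rcases eq_or_ne (weinsteinMeasure d α Ω) 0 with hΩ0 | hΩ0
    · rw [hrestrict, Measure.restrict_eq_zero.2 hΩ0, eLpNorm_measure_zero]
      exact zero_le
    rcases eq_or_ne (eLpNorm ψ p (weinsteinMeasure d α)) 0 with h0 | h0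
    · refine (eLpNorm_indicator_le ψ).trans ?_
      rw [h0]
      exact zero_le
    · rw [hSt, ENNReal.top_rpow_of_pos hpr, ENNReal.top_mul (by simp [hΩ0]),
        ENNReal.top_mul h0]
      exact le_top
  · rw [hrestrict]
    have h := eLpNorm_le_eLpNorm_mul_rpow_measure_univ (μ := (weinsteinMeasure d α).restrict Ω)
      (f := ψ) (p := p) (q := ∞) le_top hψ.1.1.restrict
    rw [Measure.restrict_apply_univ, ENNReal.toReal_top, div_zero, sub_zero] at h
    calc _ ≤ _ := h
      _ ≤ eLpNorm ψ ∞ (weinsteinMeasure d α) * weinsteinMeasure d α Ω ^ (1 / p.toReal) := by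
        gcongr
        exact Measure.restrict_le_self
      _ ≤ _ := by
        rw [mul_right_comm]
        gcongr
        exact hψ.eLpNorm_top_le hα hp1 hp2 hS hSt

theorem mainTheorem6 (d : ℕ) (α : ℝ) (hα : -1 / 2 < α) (p : ℝ≥0∞) (hp1 : 1 ≤ p) (hp2 : p ≤ 2)
    (Ω S : Set (WSpace d)) (hΩ : MeasurableSet Ω) (hS : MeasurableSet S) :
    (∀ ψ : WSpace d → ℂ, IsBandlimited α p S ψ →
      eLpNorm (timeLimit Ω ψ) p (weinsteinMeasure d α) ≤
        weinsteinMeasure d α S ^ (1 / p.toReal) * weinsteinMeasure d α Ω ^ (1 / p.toReal) *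
          eLpNorm ψ p (weinsteinMeasure d α)) ∧
    (∀ (ε : ℝ≥0) (φ : WSpace d → ℂ), MemLp φ p (weinsteinMeasure d α) →
      IsEpsBandlimited α p S ε φ →
      eLpNorm (timeLimit Ω φ) p (weinsteinMeasure d α) ≤
        ((1 + ε) * weinsteinMeasure d α S ^ (1 / p.toReal) *
            weinsteinMeasure d α Ω ^ (1 / p.toReal) + ε) *
          eLpNorm φ p (weinsteinMeasure d α)) := by
  refine ⟨fun ψ hψ => hψ.eLpNorm_timeLimit_le hα hp1 hp2 hΩ hS, fun ε φ hφ hε => ?_⟩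
  obtain ⟨ψ, hψ, hd⟩ := hε
  have hsplit : timeLimit Ω φ = timeLimit Ω ψ + timeLimit Ω (φ - ψ) := by
    rw [timeLimit, timeLimit, timeLimit, ← Set.indicator_add', add_sub_cancel]
  have hψφ : eLpNorm ψ p (weinsteinMeasure d α) ≤
      (1 + ε) * eLpNorm φ p (weinsteinMeasure d α) := by
    have h := eLpNorm_sub_le hφ.1 (hφ.1.sub hψ.1.1) hp1
    rw [sub_sub_cancel] at h
    rw [add_mul, one_mul]
    exact h.trans (by gcongr)
  calc eLpNorm (timeLimit Ω φ) p (weinsteinMeasure d α)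
      ≤ eLpNorm (timeLimit Ω ψ) p (weinsteinMeasure d α) +
        eLpNorm (timeLimit Ω (φ - ψ)) p (weinsteinMeasure d α) := by
        rw [hsplit]
        exact eLpNorm_add_le (hψ.1.1.indicator hΩ) ((hφ.1.sub hψ.1.1).indicator hΩ) hp1
    _ ≤ weinsteinMeasure d α S ^ (1 / p.toReal) * weinsteinMeasure d α Ω ^ (1 / p.toReal) *
          ((1 + ε) * eLpNorm φ p (weinsteinMeasure d α)) +
        ε * eLpNorm φ p (weinsteinMeasure d α) := by
        refine add_le_add ?_ ((eLpNorm_indicator_le _).trans hd)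
        refine (hψ.eLpNorm_timeLimit_le hα hp1 hp2 hΩ hS).trans ?_
        gcongr
    _ = _ := by ring
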